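/- For $0<t_1<t_2$ let $S^2[t_1,t_2]=\{p\in\mathbb R^3 : t_1\le\|p\|\le t_2\}$. A *tangle* in $S^2[t_1,t_2]$ is a smoothly and neatly embedded disjoint union of $n\ge 1$ arcs, each running from a point $p$ of the inner boundary sphere to the point $(t_2/t_1)p$ of the outer one (neat: the arcs meet the boundary exactly in their endpoints, and transversely there). A *block* is a pair $(S^2[t_1,t_2],\tau)$ with $\tau$ a tangle. Two blocks are *diffeomorphic* ($\approx$) if there is a diffeomorphism of their thickened spheres carrying one tangle onto the other; it need not preserve orientations or the individual boundary spheres. A *trivial block* $\varepsilon_n$ is a block whose tangle has $n$ components, each contained in a straight ray emanating from the origin. For a block $B=(S^2[t_1,t_2],\tau)$, let $\overline B$ be its reflection across the $xy$-plane and $B^{*}$ its image under the inversion $p\mapsto (t_1+t_2-\|p\|)\,p/\|p\|$. Let $A=(S^2[1,2],T)$, where $T=T_0\cup T_1\cup T_2$ and $T_k$ is the curve given, in cylindrical coordinates (distance $r$ from the $z$-axis, angle $\theta$, height $z$) and for $-1\le u\le 1$, by $$ r=\tfrac32+\tfrac23\,u\left(u^2-\tfrac14\right),\qquad \theta=\tfrac{4\pi}{3}(1-u^2)\left(\tfrac12-u\right)+\tfrac{2\pi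 k}{3},\qquad z=\tfrac12(1-u^2). $$ Let $\mathfrak B=\{A,\overline A,A^{*},\overline{A^{*}}\}$. **Corollary.** $A\not\approx\varepsilon_3$ for every trivial block $\varepsilon_3$ with three components. Moreover, the blocks in $\mathfrak B$ are pairwise diffeomorphic, and no block in $\mathfrak B$ is diffeomorphic to a trivial block $\varepsilon_3$. -/

import Mathlib

open Set
open scoped ContDiff

noncomputable section

/-- Euclidean three-space with the standard euclidean norm. -/
abbrev E3 : Type := EuclideanSpace ℝ (Fin 3)

/-- The thickened sphere `S²[t₁,t₂]`, the points `p` of three-space with `t₁ ≤ ‖p‖ ≤ t₂`. -/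
def thickenedSphere (t₁ t₂ : ℝ) : Set E3 := {p | t₁ ≤ ‖p‖ ∧ ‖p‖ ≤ t₂}

/-- The union of the arcs `γ k ([0,1])`. -/
def arcUnion {n : ℕ} (γ : Fin n → ℝ → E3) : Set E3 := ⋃ k, γ k '' Icc (0 : ℝ) 1

/-- The arcs `γ k : [0,1] → S²[t₁,t₂]` (only the values on `[0,1]` matter) are the components of a
tangle: together they form a smooth embedding of `n` copies of `[0,1]` as a neat submanifold, each
arc starting at a point `p` of the inner sphere and ending at the point `(t₂/t₁) p` of the outer
sphere. -/
structure IsTangle (t₁ t₂ : ℝ) {n : ℕ} (γ : Fin n → ℝ → E3) : Prop where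
  smooth : ∀ k, ContDiffOn ℝ ∞ (γ k) (Icc 0 1)
  immersion : ∀ k, ∀ s ∈ Icc (0 : ℝ) 1, derivWithin (γ k) (Icc 0 1) s ≠ 0
  injective : ∀ j k, ∀ s ∈ Icc (0 : ℝ) 1, ∀ t ∈ Icc (0 : ℝ) 1, γ j s = γ k t → j = k ∧ s = t
  initial : ∀ k, ‖γ k 0‖ = t₁
  terminal : ∀ k, γ k 1 = (t₂ / t₁) • γ k 0
  interior : ∀ k, ∀ s ∈ Ioo (0 : ℝ) 1, t₁ < ‖γ k s‖ ∧ ‖γ k s‖ < t₂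
  /-- At the two boundary points the velocity is not tangent to the boundary sphere. -/
  transverse : ∀ k, ∀ s ∈ ({0, 1} : Set ℝ),
    inner ℝ (γ k s) (derivWithin (γ k) (Icc 0 1) s) ≠ 0

/-- A block: a thickened sphere together with a tangle in it (as a subset). -/
structure Block where
  innerRadius : ℝ
  outerRadius : ℝ
  innerRadius_pos : 0 < innerRadius
  inner_lt_outer : innerRadius < outerRadius
  tangle : Set E3
  isTangle : ∃ n : ℕ, 1 ≤ n ∧ ∃ γ : Fin n → ℝ → E3,
    IsTangle innerRadius outerRadius γ ∧ tangle = arcUnion γ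

namespace Block

/-- The thickened sphere underlying a block. -/
def space (B : Block) : Set E3 := thickenedSphere B.innerRadius B.outerRadius

/-- `B ≈ C`: there is a diffeomorphism of the thickened spheres (smooth up to the boundary, with
smooth inverse) that carries the tangle of `B` onto the tangle of `C`. Nothing is required about
orientations or about the two boundary spheres. -/
def Diffeomorphic (B C : Block) : Prop :=
  ∃ f g : E3 → E3, ContDiffOn ℝ ∞ f B.space ∧ ContDiffOn ℝ ∞ g C.space ∧
    MapsTo f B.space C.space ∧ MapsTo g C.space B.space ∧
    LeftInvOn g f B.space ∧ LeftInvOn f g C.space ∧ f '' B.tangle = C.tangle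

/-- `B` is a trivial block `ε_n`: its tangle has `n` components, and it is radial, that is, each
component lies in a ray that is straight and emanates from the origin. -/
def IsTrivial (n : ℕ) (B : Block) : Prop :=
  ∃ γ : Fin n → ℝ → E3, IsTangle B.innerRadius B.outerRadius γ ∧ B.tangle = arcUnion γ ∧
    ∀ k, ∃ v : E3, v ≠ 0 ∧ γ k '' Icc (0 : ℝ) 1 ⊆ {p | ∃ c : ℝ, 0 ≤ c ∧ p = c • v}

end Block

theorem IsTangle.norm_one {t₁ t₂ : ℝ} {n : ℕ} {γ : Fin n → ℝ → E3}
    (h₁ : 0 < t₁) (h₂ : t₁ < t₂) (h : IsTangle t₁ t₂ γ) (k : Fin n) : ‖γ k 1‖ = t₂ := by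
  have : 0 < t₂ := h₁.trans h₂
  rw [h.terminal k, norm_smul, h.initial k, Real.norm_of_nonneg (by positivity)]
  field_simp

theorem IsTangle.mem_thickenedSphere {t₁ t₂ : ℝ} {n : ℕ} {γ : Fin n → ℝ → E3}
    (h₁ : 0 < t₁) (h₂ : t₁ < t₂) (h : IsTangle t₁ t₂ γ) (k : Fin n) {s : ℝ}
    (hs : s ∈ Icc (0 : ℝ) 1) : γ k s ∈ thickenedSphere t₁ t₂ := by
  rcases eq_or_lt_of_le hs.1 with h0 | h0
  · subst h0
    exact ⟨(h.initial k).ge, (h.initial k).le.trans h₂.le⟩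
  rcases eq_or_lt_of_le hs.2 with h1 | h1
  · subst h1
    have : ‖γ k 1‖ = t₂ := h.norm_one h₁ h₂ k
    exact ⟨this ▸ h₂.le, this.le⟩
  · exact ⟨(h.interior k s ⟨h0, h1⟩).1.le, (h.interior k s ⟨h0, h1⟩).2.le⟩

theorem IsTangle.hasDerivWithinAt {t₁ t₂ : ℝ} {n : ℕ} {γ : Fin n → ℝ → E3}
    (h : IsTangle t₁ t₂ γ) (k : Fin n) {s : ℝ} (hs : s ∈ Icc (0 : ℝ) 1) :
    HasDerivWithinAt (γ k) (derivWithin (γ k) (Icc 0 1) s) (Icc 0 1) s :=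
  (((h.smooth k).differentiableOn (by simp)) s hs).hasDerivWithinAt

/-! ### Reflection across the `xy`-plane -/

/-- The reflection of three-space across the `xy`-plane. -/
def xyReflection : E3 ≃ₗᵢ[ℝ] E3 := (ℝ ∙ (EuclideanSpace.single (2 : Fin 3) (1 : ℝ)))ᗮ.reflection

theorem IsTangle.map_isometry {t₁ t₂ : ℝ} {n : ℕ} {γ : Fin n → ℝ → E3} (h : IsTangle t₁ t₂ γ)
    (R : E3 ≃ₗᵢ[ℝ] E3) : IsTangle t₁ t₂ (fun k s => R (γ k s)) := by
  have hd : ∀ k, ∀ s ∈ Icc (0 : ℝ) 1, derivWithin (fun s => R (γ k s)) (Icc 0 1) s =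
      R (derivWithin (γ k) (Icc 0 1) s) := by
    intro k s hs
    have h1 := (R.toContinuousLinearEquiv.toContinuousLinearMap.hasFDerivAt
      (x := γ k s)).comp_hasDerivWithinAt s (h.hasDerivWithinAt k hs)
    exact h1.derivWithin (uniqueDiffOn_Icc_zero_one s hs)
  refine ⟨fun k => R.contDiff.comp_contDiffOn (h.smooth k), ?_, ?_, ?_, ?_, ?_, ?_⟩
  · intro k s hs
    rw [hd k s hs]
    simpa using h.immersion k s hs
  · intro j k s hs t ht e
    exact h.injective j k s hs t ht (R.injective e)
  · intro k
    simpa using h.initial k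
  · intro k
    rw [h.terminal k, map_smul]
  · intro k s hs
    simpa using h.interior k s hs
  · intro k s hs
    have hs' : s ∈ Icc (0 : ℝ) 1 := by
      rcases hs with rfl | rfl <;> simp
    rw [hd k s hs', R.inner_map_map]
    exact h.transverse k s hs

namespace Block

/-- The reflection of a block across the `xy`-plane. -/
def bar (B : Block) : Block where
  innerRadius := B.innerRadius
  outerRadius := B.outerRadius
  innerRadius_pos := B.innerRadius_pos
  inner_lt_outer := B.inner_lt_outer
  tangle := xyReflection '' B.tangle
  isTangle := by
    obtain ⟨n, hn, γ, hγ, e⟩ := B.isTangle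
    refine ⟨n, hn, _, hγ.map_isometry xyReflection, ?_⟩
    rw [e, arcUnion, arcUnion, image_iUnion]
    simp only [image_image]

end Block

/-! ### Inversion across the intermediate sphere -/

/-- The inversion of `S²[t₁,t₂]` across the sphere of radius `(t₁ + t₂) / 2`. -/
def shellInversion (t₁ t₂ : ℝ) (p : E3) : E3 := ((t₁ + t₂ - ‖p‖) / ‖p‖) • p

theorem norm_shellInversion {t₁ t₂ : ℝ} (h₁ : 0 < t₁) {p : E3}
    (hp : p ∈ thickenedSphere t₁ t₂) : ‖shellInversion t₁ t₂ p‖ = t₁ + t₂ - ‖p‖ := by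
  have h0 : 0 < ‖p‖ := h₁.trans_le hp.1
  have h3 : 0 ≤ t₁ + t₂ - ‖p‖ := by linarith [hp.2]
  rw [shellInversion, norm_smul, Real.norm_of_nonneg (by positivity)]
  field_simp

theorem shellInversion_shellInversion {t₁ t₂ : ℝ} (h₁ : 0 < t₁) {p : E3}
    (hp : p ∈ thickenedSphere t₁ t₂) : shellInversion t₁ t₂ (shellInversion t₁ t₂ p) = p := by
  have h0 : 0 < ‖p‖ := h₁.trans_le hp.1
  have h3 : 0 < t₁ + t₂ - ‖p‖ := by linarith [hp.2]
  have h4 := norm_shellInversion h₁ hp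
  rw [shellInversion, h4, shellInversion, smul_smul]
  have : (t₁ + t₂ - (t₁ + t₂ - ‖p‖)) / (t₁ + t₂ - ‖p‖) * ((t₁ + t₂ - ‖p‖) / ‖p‖) = 1 := by
    field_simp
    ring
  rw [this, one_smul]

theorem shellInversion_mem {t₁ t₂ : ℝ} (h₁ : 0 < t₁) {p : E3}
    (hp : p ∈ thickenedSphere t₁ t₂) : shellInversion t₁ t₂ p ∈ thickenedSphere t₁ t₂ := by
  have h4 := norm_shellInversion h₁ hp
  constructor <;> rw [h4] <;> linarith [hp.1, hp.2]

theorem contDiffAt_shellInversion (t₁ t₂ : ℝ) {p : E3} (hp : p ≠ 0) :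
    ContDiffAt ℝ ∞ (shellInversion t₁ t₂) p := by
  have hn : ContDiffAt ℝ ∞ (fun q : E3 => ‖q‖) p := contDiffAt_norm ℝ hp
  exact ((contDiffAt_const.sub hn).div hn (norm_ne_zero_iff.2 hp)).smul contDiffAt_id

theorem IsTangle.inversion {t₁ t₂ : ℝ} {n : ℕ} {γ : Fin n → ℝ → E3} (h₁ : 0 < t₁)
    (h₂ : t₁ < t₂) (h : IsTangle t₁ t₂ γ) :
    IsTangle t₁ t₂ (fun k s => shellInversion t₁ t₂ (γ k (1 - s))) := by
  have hrev : ∀ s ∈ Icc (0 : ℝ) 1, 1 - s ∈ Icc (0 : ℝ) 1 := fun s hs =>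
    ⟨by linarith [hs.2], by linarith [hs.1]⟩
  have hmem : ∀ k, ∀ s ∈ Icc (0 : ℝ) 1, γ k (1 - s) ∈ thickenedSphere t₁ t₂ := fun k s hs =>
    h.mem_thickenedSphere h₁ h₂ k (hrev s hs)
  have hne : ∀ p ∈ thickenedSphere t₁ t₂, p ≠ 0 := fun p hp =>
    norm_pos_iff.1 (h₁.trans_le hp.1)
  have hsm : ∀ k, ContDiffOn ℝ ∞ (fun s => shellInversion t₁ t₂ (γ k (1 - s))) (Icc 0 1) := by
    intro k s hs
    have h5 : ContDiffOn ℝ ∞ (fun s => γ k (1 - s)) (Icc 0 1) :=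
      (h.smooth k).comp (by fun_prop) hrev
    exact ContDiffAt.comp_contDiffWithinAt (g := shellInversion t₁ t₂)
      (f := fun s => γ k (1 - s)) s (contDiffAt_shellInversion t₁ t₂ (hne _ (hmem k s hs)))
      (h5 s hs)
  have hder : ∀ k, ∀ s ∈ Icc (0 : ℝ) 1, HasDerivWithinAt (fun s => γ k (1 - s))
      (-derivWithin (γ k) (Icc 0 1) (1 - s)) (Icc 0 1) s := by
    intro k s hs
    have h6 : HasDerivWithinAt (fun s : ℝ => 1 - s) (-1) (Icc 0 1) s := by
      simpa using (hasDerivWithinAt_id s (Icc (0 : ℝ) 1)).const_sub 1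
    simpa [Function.comp_def] using
      HasDerivWithinAt.scomp s (h.hasDerivWithinAt k (hrev s hs)) h6 hrev
  have hder' : ∀ k, ∀ s ∈ Icc (0 : ℝ) 1,
      HasDerivWithinAt (fun s => shellInversion t₁ t₂ (γ k (1 - s)))
      (derivWithin (fun s => shellInversion t₁ t₂ (γ k (1 - s))) (Icc 0 1) s) (Icc 0 1) s :=
    fun k s hs => (((hsm k).differentiableOn (by simp)) s hs).hasDerivWithinAt
  have hnorm : ∀ k, ∀ s ∈ Icc (0 : ℝ) 1,
      ‖shellInversion t₁ t₂ (γ k (1 - s))‖ = t₁ + t₂ - ‖γ k (1 - s)‖ := fun k s hs =>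
    norm_shellInversion h₁ (hmem k s hs)
  have hends : ∀ k, ‖γ k 1‖ = t₂ := h.norm_one h₁ h₂
  have h₂' : 0 < t₂ := h₁.trans h₂
  refine ⟨hsm, ?_, ?_, ?_, ?_, ?_, ?_⟩
  · intro k s hs hz
    have h7 := hder' k s hs
    rw [hz] at h7
    have h8 := HasFDerivAt.comp_hasDerivWithinAt (l := shellInversion t₁ t₂)
      (f := fun s => shellInversion t₁ t₂ (γ k (1 - s))) s
      ((contDiffAt_shellInversion t₁ t₂ (hne _ (shellInversion_mem h₁
        (hmem k s hs)))).differentiableAt (by simp)).hasFDerivAt h7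
    rw [map_zero] at h8
    have h9 : HasDerivWithinAt (fun s => γ k (1 - s)) 0 (Icc 0 1) s :=
      h8.congr (fun t ht => (shellInversion_shellInversion h₁ (hmem k t ht)).symm)
        (shellInversion_shellInversion h₁ (hmem k s hs)).symm
    have h10 := (uniqueDiffOn_Icc_zero_one s hs).eq_deriv _ (hder k s hs) h9
    exact h.immersion k _ (hrev s hs) (neg_eq_zero.1 h10)
  · intro j k s hs t ht e
    have e' := congrArg (shellInversion t₁ t₂) e
    simp only [shellInversion_shellInversion h₁ (hmem j s hs),
      shellInversion_shellInversion h₁ (hmem k t ht)] at e'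
    obtain ⟨a, b⟩ := h.injective j k _ (hrev s hs) _ (hrev t ht) e'
    exact ⟨a, by linarith⟩
  · intro k
    have := hnorm k 0 (by simp)
    simp only [sub_zero] at this ⊢
    rw [this, hends]
    ring
  · intro k
    simp only [sub_self, sub_zero, shellInversion, hends, h.initial]
    rw [h.terminal k, smul_smul, smul_smul]
    congr 1
    field_simp
    ring
  · intro k s hs
    have := hnorm k s ⟨hs.1.le, hs.2.le⟩
    have h11 := h.interior k (1 - s) ⟨by linarith [hs.2], by linarith [hs.1]⟩
    simp only [this]
    constructor <;> linarith [h11.1, h11.2]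
  · intro k s hs
    have hs' : s ∈ Icc (0 : ℝ) 1 := by
      rcases hs with rfl | rfl <;> simp
    have hsr : 1 - s ∈ ({0, 1} : Set ℝ) := by
      rcases hs with rfl | rfl <;> simp
    intro hz
    have hA := (hder' k s hs').norm_sq
    simp only [hz, mul_zero] at hA
    have hB := (hder k s hs').norm_sq
    have hpos : 0 < ‖γ k (1 - s)‖ := h₁.trans_le (hmem k s hs').1
    have hC := (hder k s hs').differentiableWithinAt.norm ℝ (norm_pos_iff.1 hpos)
    have hC' := hC.hasDerivWithinAt
    set d := derivWithin (fun s => ‖γ k (1 - s)‖) (Icc 0 1) s with hdd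
    have hD : HasDerivWithinAt (fun s => (t₁ + t₂ - ‖γ k (1 - s)‖) ^ 2)
        (2 * (t₁ + t₂ - ‖γ k (1 - s)‖) * -d) (Icc 0 1) s := by
      simpa using (hC'.const_sub (t₁ + t₂)).fun_pow 2
    have hE : HasDerivWithinAt (fun s => (t₁ + t₂ - ‖γ k (1 - s)‖) ^ 2) 0 (Icc 0 1) s :=
      hA.congr (fun t ht => by rw [hnorm k t ht]) (by rw [hnorm k s hs'])
    have hF : HasDerivWithinAt (fun s => ‖γ k (1 - s)‖ ^ 2) (2 * ‖γ k (1 - s)‖ * d)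
        (Icc 0 1) s := by
      simpa using hC'.fun_pow 2
    have hU := uniqueDiffOn_Icc_zero_one s hs'
    have e1 := hU.eq_deriv _ hD hE
    have e2 := hU.eq_deriv _ hB hF
    have hpos' : 0 < t₁ + t₂ - ‖γ k (1 - s)‖ := by linarith [(hmem k s hs').2]
    have hd0 : d = 0 := by
      rcases mul_eq_zero.1 e1 with h' | h'
      · nlinarith
      · linarith
    rw [hd0, mul_zero, inner_neg_right] at e2
    exact h.transverse k (1 - s) hsr (by linarith)

namespace Block

/-- The inversion of a block across its intermediate sphere. -/
def star (B : Block) : Block where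
  innerRadius := B.innerRadius
  outerRadius := B.outerRadius
  innerRadius_pos := B.innerRadius_pos
  inner_lt_outer := B.inner_lt_outer
  tangle := shellInversion B.innerRadius B.outerRadius '' B.tangle
  isTangle := by
    obtain ⟨n, hn, γ, hγ, e⟩ := B.isTangle
    refine ⟨n, hn, _, hγ.inversion B.innerRadius_pos B.inner_lt_outer, ?_⟩
    rw [e, arcUnion, arcUnion, image_iUnion]
    refine iUnion_congr fun k => ?_
    rw [image_image]
    ext p
    constructor
    · rintro ⟨s, hs, rfl⟩
      exact ⟨1 - s, ⟨by linarith [hs.2], by linarith [hs.1]⟩, by simp⟩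
    · rintro ⟨s, hs, rfl⟩
      exact ⟨1 - s, ⟨by linarith [hs.2], by linarith [hs.1]⟩, by simp⟩

end Block

/-! ### The block `A`

In cylindrical coordinates, the first component of the tangle has radius `tangleRadius u`, height
`tangleHeight u` and angle `tangleAngle u`, where `u` runs from `-1` to `1`; the other two components
are obtained from it by rotation through `2π/3` and `4π/3` about the `z`-axis. In the half-plane of
points (radius, height) the curve starts at `(1, 0)`, passes through the double point `(3/2, 3/8)`
at `u = -1/2`, runs once counterclockwise around a small loop above that point, passes through it
again at `u = 1/2`, and ends at `(2, 0)`. The angle is `0` at the start, `π` at the first passage,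
`0` at the second passage, and `0` at the end. -/

/-- Distance from the `z`-axis. -/
def tangleRadius (u : ℝ) : ℝ := 3 / 2 + 2 / 3 * u * (u ^ 2 - 1 / 4)

/-- Height above the `xy`-plane. -/
def tangleHeight (u : ℝ) : ℝ := (1 - u ^ 2) / 2

/-- Angle about the `z`-axis of the first component. -/
def tangleAngle (u : ℝ) : ℝ := 4 * Real.pi / 3 * (1 - u ^ 2) * (1 / 2 - u)

/-- Component `k` of the tangle of `A`, as a curve in the parameter `u ∈ [-1,1]`. -/
def tangleCurve (k : Fin 3) (u : ℝ) : E3 :=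
  !₂[tangleRadius u * Real.cos (tangleAngle u + 2 * Real.pi * (k : ℝ) / 3),
    tangleRadius u * Real.sin (tangleAngle u + 2 * Real.pi * (k : ℝ) / 3),
    tangleHeight u]

/-- Component `k` of the tangle of `A`, as a curve in the parameter `s ∈ [0,1]`. -/
def tangleArc (k : Fin 3) (s : ℝ) : E3 := tangleCurve k (2 * s - 1)

theorem norm_tangleCurve_sq (k : Fin 3) (u : ℝ) :
    ‖tangleCurve k u‖ ^ 2 = tangleRadius u ^ 2 + tangleHeight u ^ 2 := by
  rw [EuclideanSpace.norm_sq_eq]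
  simp only [Fin.sum_univ_three, tangleCurve, Real.norm_eq_abs, sq_abs]
  simp only [Matrix.cons_val_zero, Matrix.cons_val_one, Matrix.cons_val]
  linear_combination tangleRadius u ^ 2 *
    Real.sin_sq_add_cos_sq (tangleAngle u + 2 * Real.pi * (k : ℝ) / 3)

theorem tangleRadius_sub_one (u : ℝ) :
    tangleRadius u - 1 = (u + 1) * (2 / 3 * u ^ 2 - 2 / 3 * u + 1 / 2) := by
  rw [tangleRadius]; ring

theorem two_sub_tangleRadius (u : ℝ) :
    2 - tangleRadius u = (1 - u) * (2 / 3 * u ^ 2 + 2 / 3 * u + 1 / 2) := by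
  rw [tangleRadius]; ring

theorem tangleRadius_pos {u : ℝ} (h : -1 ≤ u) : 0 < tangleRadius u := by
  have h1 := tangleRadius_sub_one u
  have h2 : 0 ≤ (u + 1) * (2 / 3 * u ^ 2 - 2 / 3 * u + 1 / 2) :=
    mul_nonneg (by linarith) (by nlinarith [sq_nonneg (u - 1 / 2)])
  linarith

theorem contDiff_tangleCurve (k : Fin 3) : ContDiff ℝ ∞ (tangleCurve k) := by
  refine contDiff_euclidean.2 fun i => ?_
  fin_cases i <;>
    simp [tangleCurve, tangleRadius, tangleAngle, tangleHeight] <;> fun_prop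

theorem contDiff_tangleArc (k : Fin 3) : ContDiff ℝ ∞ (tangleArc k) :=
  (contDiff_tangleCurve k).comp (by fun_prop)

theorem hasDerivAt_tangleHeight (u : ℝ) : HasDerivAt tangleHeight (-u) u := by
  unfold tangleHeight
  refine ((((hasDerivAt_id' u).fun_pow 2).const_sub 1).div_const (2 : ℝ)).congr_deriv ?_
  norm_num
  ring

theorem hasDerivAt_norm_tangleCurve_sq (k : Fin 3) (u : ℝ) :
    HasDerivAt (fun u => ‖tangleCurve k u‖ ^ 2)
      (2 * tangleRadius u * (2 * u ^ 2 - 1 / 6) + 2 * tangleHeight u * -u) u := by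
  simp only [norm_tangleCurve_sq]
  have hr : HasDerivAt tangleRadius (2 * u ^ 2 - 1 / 6) u := by
    unfold tangleRadius
    have h := ((hasDerivAt_id' u).const_mul (2 / 3 : ℝ)).fun_mul
      (((hasDerivAt_id' u).fun_pow 2).sub_const (1 / 4 : ℝ))
    refine (h.const_add (3 / 2 : ℝ)).congr_deriv ?_
    norm_num
    ring
  have hz := hasDerivAt_tangleHeight u
  refine ((hr.fun_pow 2).fun_add (hz.fun_pow 2)).congr_deriv ?_
  norm_num

theorem deriv_tangleCurve_ne_zero (k : Fin 3) (u : ℝ) :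
    deriv (tangleCurve k) u ≠ 0 := by
  intro h0
  have hd : HasDerivAt (tangleCurve k) 0 u :=
    h0 ▸ ((contDiff_tangleCurve k).differentiable (by simp) u).hasDerivAt
  have hz := (EuclideanSpace.proj (𝕜 := ℝ) (2 : Fin 3)).hasFDerivAt.comp_hasDerivAt u hd
  rw [map_zero] at hz
  have hz' := hasDerivAt_tangleHeight u
  have hz2 : HasDerivAt tangleHeight 0 u := hz
  have hu : u = 0 := by linarith [hz'.unique hz2]
  have hn := hd.norm_sq
  simp only [inner_zero_right, mul_zero] at hn
  have := hn.unique (hasDerivAt_norm_tangleCurve_sq k u)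
  rw [hu] at this
  norm_num [tangleRadius] at this

theorem tangleCurve_injective (j k : Fin 3) {u v : ℝ} (hu : -1 ≤ u) (hv : -1 ≤ v)
    (h : tangleCurve j u = tangleCurve k v) : j = k ∧ u = v := by
  have h0 : tangleRadius u * Real.cos (tangleAngle u + 2 * Real.pi * (j : ℝ) / 3) =
      tangleRadius v * Real.cos (tangleAngle v + 2 * Real.pi * (k : ℝ) / 3) := by
    simpa [tangleCurve] using congrArg (fun p : E3 => p 0) h
  have h1 : tangleRadius u * Real.sin (tangleAngle u + 2 * Real.pi * (j : ℝ) / 3) =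
      tangleRadius v * Real.sin (tangleAngle v + 2 * Real.pi * (k : ℝ) / 3) := by
    simpa [tangleCurve] using congrArg (fun p : E3 => p 1) h
  have h2 : tangleHeight u = tangleHeight v := by
    simpa [tangleCurve] using congrArg (fun p : E3 => p 2) h
  have hru := tangleRadius_pos hu
  have hrv := tangleRadius_pos hv
  have hr : tangleRadius u = tangleRadius v := by
    have h3 : tangleRadius u ^ 2 = tangleRadius v ^ 2 := by
      have := congrArg (fun p : E3 => ‖p‖ ^ 2) h
      simp only [norm_tangleCurve_sq, h2] at this
      linarith
    nlinarith
  have huv : (u - v) * (u + v) = 0 := by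
    unfold tangleHeight at h2
    linarith
  have hangle : ∃ n : ℤ, tangleAngle u + 2 * Real.pi * (j : ℝ) / 3 =
      tangleAngle v + 2 * Real.pi * (k : ℝ) / 3 + 2 * Real.pi * n := by
    rw [hr] at h0 h1
    have hc := mul_left_cancel₀ hrv.ne' h0
    have hs := mul_left_cancel₀ hrv.ne' h1
    obtain ⟨n, hn⟩ := Real.Angle.angle_eq_iff_two_pi_dvd_sub.1 (Real.Angle.cos_sin_inj hc hs)
    exact ⟨n, by linarith⟩
  obtain ⟨n, hn⟩ := hangle
  have hpi := Real.pi_pos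
  have key : ∀ m : ℤ, u = v → j = k := by
    intro _ e
    subst e
    have h4 : Real.pi * ((j : ℝ) - k - 3 * n) = 0 := by linarith
    have h5 : ((j : ℝ) - k - 3 * n) = 0 := (mul_eq_zero.1 h4).resolve_left hpi.ne'
    have h6 : (j : ℤ) - (k : ℤ) - 3 * n = 0 := by
      have : (((j : ℤ) - (k : ℤ) - 3 * n : ℤ) : ℝ) = 0 := by push_cast; exact h5
      exact_mod_cast this
    omega
  rcases mul_eq_zero.1 huv with e | e
  · have e' : u = v := by linarith
    exact ⟨key 0 e', e'⟩
  have e' : v = -u := by linarith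
  subst e'
  have h7 : u * ((u - 1 / 2) * (u + 1 / 2)) = 0 := by
    unfold tangleRadius at hr
    linarith
  rcases mul_eq_zero.1 h7 with h8 | h8
  · have e'' : u = -u := by linarith
    exact ⟨key 0 e'', e''⟩
  exfalso
  have h9 : ∃ w : ℤ, Real.pi * (3 * w + 2 * ((j : ℝ) - k - 3 * n)) = 0 ∧ (w = 1 ∨ w = -1) := by
    rcases mul_eq_zero.1 h8 with h9 | h9
    · refine ⟨-1, ?_, by simp⟩
      have : u = 1 / 2 := by linarith
      subst this
      unfold tangleAngle at hn
      push_cast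
      linarith
    · refine ⟨1, ?_, by simp⟩
      have : u = -1 / 2 := by linarith
      subst this
      unfold tangleAngle at hn
      push_cast
      linarith
  obtain ⟨w, hw, hw'⟩ := h9
  have h10 := (mul_eq_zero.1 hw).resolve_left hpi.ne'
  have h11 : 3 * w + 2 * ((j : ℤ) - (k : ℤ) - 3 * n) = 0 := by
    have : ((3 * w + 2 * ((j : ℤ) - (k : ℤ) - 3 * n) : ℤ) : ℝ) = 0 := by push_cast; exact h10
    exact_mod_cast this
  omega

theorem isTangle_tangleArc : IsTangle 1 2 tangleArc := by
  have hrange : ∀ s ∈ Icc (0 : ℝ) 1, -1 ≤ 2 * s - 1 := fun s hs => by linarith [hs.1]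
  have hd : ∀ k, ∀ s ∈ Icc (0 : ℝ) 1, HasDerivWithinAt (tangleArc k)
      ((2 : ℝ) • deriv (tangleCurve k) (2 * s - 1)) (Icc 0 1) s := by
    intro k s _
    have h1 : HasDerivAt (fun s : ℝ => 2 * s - 1) 2 s := by
      simpa using ((hasDerivAt_id s).const_mul (2 : ℝ)).sub_const 1
    exact (HasDerivAt.scomp s ((contDiff_tangleCurve k).differentiable (by simp)
      (2 * s - 1)).hasDerivAt h1).hasDerivWithinAt
  have hd' : ∀ k, ∀ s ∈ Icc (0 : ℝ) 1, derivWithin (tangleArc k) (Icc 0 1) s =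
      (2 : ℝ) • deriv (tangleCurve k) (2 * s - 1) := fun k s hs =>
    (hd k s hs).derivWithin (uniqueDiffOn_Icc_zero_one s hs)
  refine ⟨fun k => (contDiff_tangleArc k).contDiffOn, ?_, ?_, ?_, ?_, ?_, ?_⟩
  · intro k s hs
    rw [hd' k s hs]
    exact smul_ne_zero two_ne_zero (deriv_tangleCurve_ne_zero k _)
  · intro j k s hs t ht h
    obtain ⟨a, b⟩ := tangleCurve_injective j k (hrange s hs) (hrange t ht) h
    exact ⟨a, by linarith⟩
  · intro k
    have h := norm_tangleCurve_sq k (2 * 0 - 1)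
    have h' : tangleRadius (2 * 0 - 1) ^ 2 + tangleHeight (2 * 0 - 1) ^ 2 = 1 := by
      norm_num [tangleRadius, tangleHeight]
    rw [h'] at h
    have h0 : 0 ≤ ‖tangleArc k 0‖ := norm_nonneg _
    have h1 : ‖tangleArc k 0‖ ^ 2 = 1 := h
    nlinarith
  · intro k
    ext i
    fin_cases i <;> norm_num [tangleArc, tangleCurve, tangleRadius, tangleHeight, tangleAngle]
  · intro k s hs
    set u := 2 * s - 1 with hu
    have hu1 : 0 < u + 1 := by linarith [hs.1]
    have hu2 : 0 < 1 - u := by linarith [hs.2]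
    have h := norm_tangleCurve_sq k u
    have e1 := tangleRadius_sub_one u
    have e2 := two_sub_tangleRadius u
    have p1 : 0 < (u + 1) * (2 / 3 * u ^ 2 - 2 / 3 * u + 1 / 2) :=
      mul_pos hu1 (by nlinarith [sq_nonneg (u - 1 / 2)])
    have hr1 : 1 < tangleRadius u := by linarith
    have hz : tangleHeight u ^ 2 = (1 - u) * ((1 - u) * (1 + u) ^ 2 / 4) := by
      rw [tangleHeight]; ring
    have hq : (1 - u) * (1 + u) ^ 2 / 4 < 3 * (2 / 3 * u ^ 2 + 2 / 3 * u + 1 / 2) := by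
      nlinarith [sq_nonneg (u + 1 / 2), mul_pos hu1 hu2, mul_pos hu1 (mul_pos hu1 hu2),
        sq_nonneg u]
    have hq' : 0 < 2 / 3 * u ^ 2 + 2 / 3 * u + 1 / 2 := by nlinarith [sq_nonneg (u + 1 / 2)]
    have hmul := mul_lt_mul_of_pos_left hq hu2
    have hr2 : (1 - u) * (3 * (2 / 3 * u ^ 2 + 2 / 3 * u + 1 / 2)) ≤
        (2 - tangleRadius u) * (2 + tangleRadius u) := by
      rw [e2]
      nlinarith [mul_pos hu2 hq']
    have hN : tangleArc k s = tangleCurve k u := rfl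
    rw [hN]
    have h0 := norm_nonneg (tangleCurve k u)
    constructor
    · nlinarith [sq_nonneg (tangleHeight u)]
    · nlinarith
  · intro k s hs
    have hs' : s ∈ Icc (0 : ℝ) 1 := by
      rcases hs with rfl | rfl <;> simp
    rw [hd' k s hs', inner_smul_right]
    have hn := ((contDiff_tangleCurve k).differentiable (by simp)
      (2 * s - 1)).hasDerivAt.norm_sq.unique (hasDerivAt_norm_tangleCurve_sq k (2 * s - 1))
    have hN : tangleArc k s = tangleCurve k (2 * s - 1) := rfl
    rw [hN, hn]
    rcases hs with rfl | rfl <;> norm_num [tangleRadius, tangleHeight]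

/-- The block `A`. -/
def blockA : Block where
  innerRadius := 1
  outerRadius := 2
  innerRadius_pos := one_pos
  inner_lt_outer := one_lt_two
  tangle := arcUnion tangleArc
  isTangle := ⟨3, by norm_num, tangleArc, isTangle_tangleArc, rfl⟩

/-- The set `𝔅` of the four blocks `A`, its reflection, its inversion, and the reflection of its
inversion. -/
def blocksB : Set Block := {blockA, blockA.bar, blockA.star, blockA.star.bar}

end

/-! Reflection and inversion are smooth involutions of the thickened sphere, so all four blocks are
diffeomorphic to `A`, and only `A` has to be told apart from trivial blocks.

In a trivial block the complement of the tangle can be pushed radially onto either boundary sphere.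
A diffeomorphism of thickened spheres carries boundary spheres to boundary spheres, so for a block
diffeomorphic to a trivial one the complement of the tangle deformation retracts onto its part in
the inner sphere, which stays pointwise fixed (`Diffeomorphic.exists_deformation`). Hence every path
in the complement with both ends on the inner sphere is homotopic, relative to its ends, to a path
inside the inner sphere.

For `A` this fails, as a fourfold covering of the complement shows. Its fibre is the field with four
elements and its transition maps are affine. The tangle lies on two surfaces of revolution, swept
out by the halves `u ≤ 0` and `u ≥ 0` of its arcs. The arcs cut the surfaces into sectors, and a
permutation is assigned to crossing each sector. The surfaces meet along the circle of double
points, where the two halves are half a turn apart, so that only sectors of different index meet;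
there the permutations fit together by `loopWall_mul_innerWall`. Over the inner sphere the only
permutations met are multiplications by powers of `ω`, so `0` is a flat section
(`isFlatAlong_zero`). A half ellipse that passes over the loop and then between the outer ends of
two arcs joins the poles of the inner sphere and transports `0` to `1` (`isFlatAlong_halfEllipse`).
Transport depends only on the homotopy class of the path (`eq_of_homotopicRel`), a contradiction. -/

open scoped unitInterval Topology

/-! ### Local systems of sets and parallel transport -/

/-- A locally constant family of sets in bijection with `F`, given by charts: `gauge i x`
identifies the fibre over `x` with `F`, and two charts differ by a locally constant permutation. -/
structure ChartedLocalSystem (X F : Type*) [TopologicalSpace X] where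
  Index : Type*
  source : Index → Set X
  gauge : Index → X → Equiv.Perm F
  isOpen_source : ∀ i, IsOpen (source i)
  exists_mem_source : ∀ x, ∃ i, x ∈ source i
  locally_constant : ∀ i j x, x ∈ source i → x ∈ source j →
    ∀ᶠ y in 𝓝 x, gauge j y * (gauge i y)⁻¹ = gauge j x * (gauge i x)⁻¹

namespace ChartedLocalSystem

variable {X F Y : Type*} [TopologicalSpace X] [TopologicalSpace Y] (L : ChartedLocalSystem X F)

/-- A family `v` of elements of the fibres over the points `c y` is flat if it is locally constant
in some chart around each point. -/
def IsFlatAlong (c : Y → X) (v : Y → F) : Prop :=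
  ∀ y, ∃ i, c y ∈ L.source i ∧ ∀ᶠ y' in 𝓝 y, L.gauge i (c y') (v y') = L.gauge i (c y) (v y)

variable [TopologicalSpace F] [DiscreteTopology F]

/-- The fibre bundle of a local system. -/
noncomputable def core : FiberBundleCore L.Index X F where
  baseSet := L.source
  isOpen_baseSet := L.isOpen_source
  indexAt x := (L.exists_mem_source x).choose
  mem_baseSet_at x := (L.exists_mem_source x).choose_spec
  coordChange i j x := (L.gauge j x * (L.gauge i x)⁻¹ : Equiv.Perm F)
  coordChange_self i x _ v := by simp
  continuousOn_coordChange i j := by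
    rintro ⟨x, v⟩ ⟨⟨hi, hj⟩, -⟩
    refine ContinuousAt.continuousWithinAt ?_
    refine (continuousAt_const (y := (L.gauge j x * (L.gauge i x)⁻¹ : Equiv.Perm F) v)).congr ?_
    have h1 : ∀ᶠ p : X × F in 𝓝 (x, v), p.2 = v :=
      continuousAt_snd.eventually (f := fun p : X × F => p.2)
        (p := fun w => w = v) (by simp [nhds_discrete])
    have h2 : ∀ᶠ p : X × F in 𝓝 (x, v), L.gauge j p.1 * (L.gauge i p.1)⁻¹ =
        L.gauge j x * (L.gauge i x)⁻¹ :=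
      (continuousAt_fst (p := (x, v))).eventually (L.locally_constant i j x hi hj)
    filter_upwards [h1, h2] with p h1 h2
    rw [h1, h2]
  coordChange_comp i j k x _ v := by simp

theorem coordChange_core_gauge (i j : L.Index) (x : X) (v : F) :
    L.core.coordChange i j x (L.gauge i x v) = L.gauge j x v := by
  simp [core]

theorem isCoveringMap_proj : IsCoveringMap (Bundle.TotalSpace.proj : L.core.TotalSpace → X) :=
  FiberBundle.isCoveringMap (F := F) (E := L.core.Fiber)

/-- The point of the covering space over `x` with value `v`. -/
noncomputable def point (x : X) (v : F) : L.core.TotalSpace :=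
  ⟨x, L.gauge (L.core.indexAt x) x v⟩

theorem point_injective (x : X) {v w : F} (h : L.point x v = L.point x w) : v = w := by
  have := congrArg (fun e : L.core.TotalSpace => (L.core.localTrivAt x e).2) h
  simpa [point] using this

-- In the trivialisation over chart `i` the second coordinate of the lifted family is `gauge i (c y)
-- (v y)`, which is locally constant by flatness. Flat families are thus continuous lifts, and
-- uniqueness of path lifting applies to them.
variable {L} in
theorem IsFlatAlong.continuous {c : Y → X} {v : Y → F} (h : L.IsFlatAlong c v)
    (hc : Continuous c) : Continuous (fun y => L.point (c y) (v y)) := by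
  refine continuous_iff_continuousAt.2 fun y => ?_
  obtain ⟨i, hi, hv⟩ := h y
  refine (L.core.localTriv i).continuousAt_of_comp_left hc.continuousAt hi ?_
  have e : (L.core.localTriv i ∘ fun y => L.point (c y) (v y)) =
      fun y => (c y, L.gauge i (c y) (v y)) := by
    funext y
    exact Prod.ext rfl (coordChange_core_gauge L _ i (c y) (v y))
  rw [e]
  exact hc.continuousAt.prodMk ((continuousAt_const (y := L.gauge i (c y) (v y))).congr
    (hv.mono fun _ h => h.symm))

omit [TopologicalSpace F] [DiscreteTopology F] in
/-- Flat families along homotopic paths that start with the same value end with the same value. -/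
theorem eq_of_homotopicRel {c₀ c₁ : C(I, X)} (h : c₀.HomotopicRel c₁ {0, 1}) {v₀ v₁ : I → F}
    (h₀ : L.IsFlatAlong c₀ v₀) (h₁ : L.IsFlatAlong c₁ v₁) (h01 : v₀ 0 = v₁ 0) : v₀ 1 = v₁ 1 := by
  -- The conclusion does not involve a topology on the fibre; the discrete one makes the bundle a
  -- covering.
  let _ : TopologicalSpace F := ⊥
  have : DiscreteTopology F := ⟨rfl⟩
  have e0 : c₀ 0 = c₁ 0 := h.some.fst_eq_snd (by simp)
  have e1 : c₀ 1 = c₁ 1 := h.some.fst_eq_snd (by simp)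
  have hm := L.isCoveringMap_proj.liftPath_apply_one_eq_of_homotopicRel h
    (L.point (c₀ 0) (v₀ 0)) rfl e0.symm
  have l0 := (L.isCoveringMap_proj.eq_liftPath_iff (γ := c₀) (e := L.point (c₀ 0) (v₀ 0))
    (γ_0 := rfl) (Γ := fun y => L.point (c₀ y) (v₀ y))).2 ⟨h₀.continuous c₀.continuous, rfl, rfl⟩
  have l1 := (L.isCoveringMap_proj.eq_liftPath_iff (γ := c₁) (e := L.point (c₀ 0) (v₀ 0))
    (γ_0 := e0.symm) (Γ := fun y => L.point (c₁ y) (v₁ y))).2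
      ⟨h₁.continuous c₁.continuous, rfl, by rw [e0, h01]⟩
  rw [← l0, ← l1] at hm
  simp only [e1] at hm
  exact L.point_injective _ hm

end ChartedLocalSystem

/-! ### Diffeomorphisms of blocks and their effect on the boundary -/

namespace Block

theorem tangle_subset_space (B : Block) : B.tangle ⊆ B.space := by
  obtain ⟨n, -, γ, hγ, e⟩ := B.isTangle
  rw [e]
  rintro p hp
  obtain ⟨k, s, hs, rfl⟩ := mem_iUnion.1 hp
  exact hγ.mem_thickenedSphere B.innerRadius_pos B.inner_lt_outer k hs

theorem ne_zero_of_mem_space {B : Block} {p : E3} (hp : p ∈ B.space) : p ≠ 0 :=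
  norm_pos_iff.1 (B.innerRadius_pos.trans_le hp.1)

theorem Diffeomorphic.symm {B C : Block} (h : B.Diffeomorphic C) : C.Diffeomorphic B := by
  obtain ⟨f, g, hf, hg, hfm, hgm, hgf, hfg, e⟩ := h
  refine ⟨g, f, hg, hf, hgm, hfm, hfg, hgf, ?_⟩
  rw [← e]
  exact (hgf.mono B.tangle_subset_space).image_image

theorem Diffeomorphic.trans {B C D : Block} (h : B.Diffeomorphic C) (h' : C.Diffeomorphic D) :
    B.Diffeomorphic D := by
  obtain ⟨f, g, hf, hg, hfm, hgm, hgf, hfg, e⟩ := h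
  obtain ⟨f', g', hf', hg', hfm', hgm', hgf', hfg', e'⟩ := h'
  refine ⟨f' ∘ f, g ∘ g', hf'.comp hf hfm, hg.comp hg' hgm', hfm'.comp hfm, hgm.comp hgm',
    ?_, ?_, by rw [image_comp, e, e']⟩
  · intro p hp
    simp only [Function.comp_apply]
    rw [hgf' (hfm hp), hgf hp]
  · intro p hp
    simp only [Function.comp_apply]
    rw [hfg (hgm' hp), hfg' hp]

theorem diffeomorphic_refl (B : Block) : B.Diffeomorphic B :=
  ⟨id, id, contDiffOn_id, contDiffOn_id, mapsTo_id _, mapsTo_id _, fun _ _ => rfl, fun _ _ => rfl,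
    image_id _⟩

theorem diffeomorphic_bar (B : Block) : B.Diffeomorphic B.bar := by
  have hm : MapsTo xyReflection B.space B.space := fun p hp => by
    simpa [space, thickenedSphere] using hp
  have hi : LeftInvOn xyReflection xyReflection B.space := fun p _ =>
    Submodule.reflection_reflection _ p
  exact ⟨xyReflection, xyReflection, xyReflection.contDiff.contDiffOn,
    xyReflection.contDiff.contDiffOn, hm, hm, hi, hi, rfl⟩

theorem diffeomorphic_star (B : Block) : B.Diffeomorphic B.star := by
  have hs : ContDiffOn ℝ ∞ (shellInversion B.innerRadius B.outerRadius) B.space := fun p hp =>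
    (contDiffAt_shellInversion _ _ (ne_zero_of_mem_space hp)).contDiffWithinAt
  have hm : MapsTo (shellInversion B.innerRadius B.outerRadius) B.space B.space := fun p hp =>
    shellInversion_mem B.innerRadius_pos hp
  have hi : LeftInvOn (shellInversion B.innerRadius B.outerRadius)
      (shellInversion B.innerRadius B.outerRadius) B.space := fun p hp =>
    shellInversion_shellInversion B.innerRadius_pos hp
  exact ⟨_, _, hs, hs, hm, hm, hi, hi, rfl⟩

/-- A smooth map between thickened spheres with a smooth inverse preserves the boundary. -/
theorem norm_apply_eq_of_boundary {B C : Block} {f g : E3 → E3} (hf : ContDiffOn ℝ ∞ f B.space)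
    (hg : ContDiffOn ℝ ∞ g C.space) (hfm : MapsTo f B.space C.space)
    (hgm : MapsTo g C.space B.space) (hgf : LeftInvOn g f B.space) (hfg : LeftInvOn f g C.space)
    {x : E3} (hx : x ∈ B.space) (hb : ‖x‖ = B.innerRadius ∨ ‖x‖ = B.outerRadius) :
    ‖f x‖ = C.innerRadius ∨ ‖f x‖ = C.outerRadius := by
  by_contra! hcon
  set y := f x with hy
  have hyC : y ∈ C.space := hfm hx
  have hgy : g y = x := hgf hx
  have hnhds : C.space ∈ 𝓝 y := by
    have h1 : ∀ᶠ q : E3 in 𝓝 y, C.innerRadius < ‖q‖ :=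
      continuous_norm.continuousAt.eventually (lt_mem_nhds (lt_of_le_of_ne hyC.1 hcon.1.symm))
    have h2 : ∀ᶠ q : E3 in 𝓝 y, ‖q‖ < C.outerRadius :=
      continuous_norm.continuousAt.eventually (gt_mem_nhds (lt_of_le_of_ne hyC.2 hcon.2))
    filter_upwards [h1, h2] with q h1 h2 using ⟨h1.le, h2.le⟩
  have hgd : DifferentiableAt ℝ g y := (hg.contDiffAt hnhds).differentiableAt (by simp)
  obtain ⟨f', hf'⟩ : DifferentiableWithinAt ℝ f B.space x := hf.differentiableOn (by simp) x hx
  set g' := fderiv ℝ g y with hg'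
  have hcomp : HasFDerivWithinAt (f ∘ g) (f'.comp g') C.space y :=
    HasFDerivWithinAt.comp y (by rwa [hgy]) hgd.hasFDerivAt.hasFDerivWithinAt hgm
  have hid : HasFDerivAt (f ∘ g) (ContinuousLinearMap.id ℝ E3) y :=
    (hasFDerivAt_id y).congr_of_eventuallyEq
      (Filter.eventually_of_mem hnhds fun q hq => hfg hq)
  have he : f'.comp g' = ContinuousLinearMap.id ℝ E3 := (hcomp.hasFDerivAt hnhds).unique hid
  -- The derivative of `g` at `y` has a left inverse, so in finite dimension it is onto; in
  -- particular the radial direction `x` is one of its values.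
  have hinj : Function.Injective (g' : E3 →ₗ[ℝ] E3) := fun v w hvw => by
    have := congrArg f' (show g' v = g' w from hvw)
    simpa [← ContinuousLinearMap.comp_apply, he] using this
  obtain ⟨v, hv⟩ := LinearMap.injective_iff_surjective.1 hinj x
  have hv' : g' v = x := hv
  have hnorm : HasFDerivAt (fun q => ‖g q‖ ^ 2) (2 • (innerSL ℝ (g y)).comp g') y :=
    hgd.hasFDerivAt.norm_sq
  -- If `f x` were an interior point, `‖g‖²` would be extremal there, since `g (f x) = x` lies on
  -- the boundary. Its derivative in the direction `v` is `2⟨x, x⟩`, which would then vanish.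
  have hext : IsLocalExtr (fun q => ‖g q‖ ^ 2) y := by
    rcases hb with hb | hb
    · left
      filter_upwards [hnhds] with q hq
      rw [hgy, hb]
      exact pow_le_pow_left₀ B.innerRadius_pos.le (hgm hq).1 2
    · right
      filter_upwards [hnhds] with q hq
      rw [hgy, hb]
      exact pow_le_pow_left₀ (norm_nonneg _) (hgm hq).2 2
  have h0 := congrArg (fun T => T v) (hext.hasFDerivAt_eq_zero hnorm)
  have h1 : inner ℝ x x = 0 := by simpa [hgy, hv'] using h0
  exact ne_zero_of_mem_space hx (inner_self_eq_zero.1 h1)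

/-- Such a map sends a boundary sphere into a boundary sphere. -/
theorem norm_apply_eq_norm_apply {B C : Block} {f g : E3 → E3} (hf : ContDiffOn ℝ ∞ f B.space)
    (hg : ContDiffOn ℝ ∞ g C.space) (hfm : MapsTo f B.space C.space)
    (hgm : MapsTo g C.space B.space) (hgf : LeftInvOn g f B.space) (hfg : LeftInvOn f g C.space)
    {R : ℝ} (hR : R = B.innerRadius ∨ R = B.outerRadius) {x y : E3} (hx : ‖x‖ = R)
    (hy : ‖y‖ = R) : ‖f x‖ = ‖f y‖ := by
  have hlt := B.inner_lt_outer
  have hsub : Metric.sphere (0 : E3) R ⊆ B.space := fun p hp => by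
    rw [mem_sphere_zero_iff_norm] at hp
    rcases hR with h | h <;> constructor <;> linarith
  have hconn : IsPreconnected (Metric.sphere (0 : E3) R) :=
    isPreconnected_sphere (by
      rw [← Module.finrank_eq_rank]
      simp) 0 R
  -- On the connected sphere the continuous function `‖f p‖` takes at most two values, hence only
  -- one.
  exact hconn.constant_of_mapsTo (T := {C.innerRadius, C.outerRadius}) (f := fun p => ‖f p‖)
    (toFinite _).isDiscrete ((hf.continuousOn.mono hsub).norm)
    (fun p hp => norm_apply_eq_of_boundary hf hg hfm hgm hgf hfg (hsub hp)
      (by rw [mem_sphere_zero_iff_norm.1 hp]; exact hR))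
    (mem_sphere_zero_iff_norm.2 hx) (mem_sphere_zero_iff_norm.2 hy)

theorem mapsTo_compl_tangle {B C : Block} {f g : E3 → E3} (hfm : MapsTo f B.space C.space)
    (hgf : LeftInvOn g f B.space) (e : f '' B.tangle = C.tangle) :
    MapsTo f (B.space \ B.tangle) (C.space \ C.tangle) := by
  rintro p ⟨hp, hpt⟩
  refine ⟨hfm hp, fun h => hpt ?_⟩
  rw [← e] at h
  obtain ⟨q, hq, hqp⟩ := h
  rwa [← hgf hp, ← hqp, hgf (B.tangle_subset_space hq)]

/-! ### Radial deformation in the complement of a trivial tangle -/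

/-- The tangle of a trivial block is invariant under radial scaling inside the thickened sphere. -/
theorem IsTrivial.mem_tangle_of_smul {n : ℕ} {E : Block} (hE : E.IsTrivial n) {p : E3} {c : ℝ}
    (hc : 0 < c) (hp : p ∈ E.space) (h : c • p ∈ E.tangle) : p ∈ E.tangle := by
  obtain ⟨γ, hγ, e, hray⟩ := hE
  rw [e] at h ⊢
  obtain ⟨k, s, hs, hsp⟩ := mem_iUnion.1 h
  obtain ⟨v, hv, hvr⟩ := hray k
  have hcont : ContinuousOn (fun s => ‖γ k s‖) (Icc 0 1) := (hγ.smooth k).continuousOn.norm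
  have hp' : ‖p‖ ∈ Icc ‖γ k 0‖ ‖γ k 1‖ := by
    rw [hγ.initial k, hγ.norm_one E.innerRadius_pos E.inner_lt_outer k]
    exact hp
  -- The component runs from the inner to the outer sphere, so it attains every intermediate norm;
  -- on a ray, a point is determined by its norm.
  obtain ⟨t, ht, htp⟩ := intermediate_value_Icc zero_le_one hcont hp'
  refine mem_iUnion.2 ⟨k, t, ht, ?_⟩
  obtain ⟨a, ha, hav⟩ := hvr ⟨s, hs, hsp⟩
  obtain ⟨b, hb, hbv⟩ := hvr ⟨t, ht, rfl⟩
  have hpv : p = (c⁻¹ * a) • v := by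
    rw [mul_smul, ← hav, smul_smul, inv_mul_cancel₀ hc.ne', one_smul]
  have hca : 0 ≤ c⁻¹ * a := by positivity
  simp only [hbv] at htp
  rw [hpv, norm_smul, norm_smul, Real.norm_of_nonneg hb, Real.norm_of_nonneg hca] at htp
  rw [hbv, hpv, mul_right_cancel₀ (norm_ne_zero_iff.2 hv) htp]

/-- Linear interpolation of the norm between `‖p‖` and `R`, keeping the direction of `p`. -/
noncomputable def radialPush (R t : ℝ) (p : E3) : E3 := (((1 - t) * ‖p‖ + t * R) / ‖p‖) • p

theorem norm_radialPush {R t : ℝ} {p : E3} (hp : p ≠ 0) (hR : 0 ≤ R) (ht : t ∈ Icc (0 : ℝ) 1) :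
    ‖radialPush R t p‖ = (1 - t) * ‖p‖ + t * R := by
  have h0 : 0 < ‖p‖ := norm_pos_iff.2 hp
  have h1 : 0 ≤ 1 - t := by linarith [ht.2]
  have h2 := ht.1
  rw [radialPush, norm_smul, Real.norm_of_nonneg (by positivity)]
  field_simp

/-- The new norm is a convex combination of `‖p‖` and `R`, so the point stays in the thickened
sphere; it moves by a positive factor, so it cannot reach a radial tangle from outside it. -/
theorem IsTrivial.radialPush_mem {n : ℕ} {E : Block} (hE : E.IsTrivial n) {R t : ℝ} {p : E3}
    (hR : R = E.innerRadius ∨ R = E.outerRadius) (ht : t ∈ Icc (0 : ℝ) 1)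
    (hp : p ∈ E.space \ E.tangle) : radialPush R t p ∈ E.space \ E.tangle := by
  have hpos := E.innerRadius_pos
  have hlt := E.inner_lt_outer
  have hR' : E.innerRadius ≤ R ∧ R ≤ E.outerRadius := by
    rcases hR with h | h <;> constructor <;> linarith
  have hp0 := ne_zero_of_mem_space hp.1
  have hn := norm_radialPush hp0 (hpos.le.trans hR'.1) ht
  have hp1 : E.innerRadius ≤ ‖p‖ ∧ ‖p‖ ≤ E.outerRadius := hp.1
  have hn0 : 0 < ‖p‖ := norm_pos_iff.2 hp0
  have hlow : E.innerRadius ≤ (1 - t) * ‖p‖ + t * R := by nlinarith [ht.1, ht.2]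
  have hup : (1 - t) * ‖p‖ + t * R ≤ E.outerRadius := by nlinarith [ht.1, ht.2]
  refine ⟨⟨by rw [hn]; exact hlow, by rw [hn]; exact hup⟩, fun h => hp.2 ?_⟩
  exact hE.mem_tangle_of_smul (div_pos (hpos.trans_le hlow) hn0) hp.1 h

/-- The complement of the tangle of a block diffeomorphic to a trivial block deformation retracts
onto its intersection with the inner sphere. -/
theorem Diffeomorphic.exists_deformation {n : ℕ} {B E : Block} (h : B.Diffeomorphic E)
    (hE : E.IsTrivial n) {x₀ : E3} (hx₀ : ‖x₀‖ = B.innerRadius) :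
    ∃ H : ℝ × E3 → E3, ContinuousOn H (Icc 0 1 ×ˢ (B.space \ B.tangle)) ∧
      (∀ t ∈ Icc (0 : ℝ) 1, ∀ p ∈ B.space \ B.tangle, H (t, p) ∈ B.space \ B.tangle) ∧
      (∀ p ∈ B.space \ B.tangle, H (0, p) = p) ∧
      (∀ p ∈ B.space \ B.tangle, ‖H (1, p)‖ = B.innerRadius) ∧
      ∀ t ∈ Icc (0 : ℝ) 1, ∀ p ∈ B.space \ B.tangle, ‖p‖ = B.innerRadius → H (t, p) = p := by
  obtain ⟨f, g, hf, hg, hfm, hgm, hgf, hfg, e⟩ := h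
  have eg : g '' E.tangle = B.tangle := by
    rw [← e]
    exact (hgf.mono B.tangle_subset_space).image_image
  have hfc := mapsTo_compl_tangle hfm hgf e
  have hgc := mapsTo_compl_tangle hgm hfg eg
  have hx₀B : x₀ ∈ B.space := ⟨hx₀.ge, hx₀.le.trans B.inner_lt_outer.le⟩
  -- `R` is the radius of the boundary sphere onto which the inner sphere is carried; it may be
  -- either of the two. The deformation is the push towards that sphere, conjugated by the
  -- diffeomorphism.
  set R := ‖f x₀‖ with hRdef
  have hR : R = E.innerRadius ∨ R = E.outerRadius :=
    norm_apply_eq_of_boundary hf hg hfm hgm hgf hfg hx₀B (Or.inl hx₀)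
  have hR0 : 0 ≤ R := norm_nonneg _
  have hpush : ∀ {p}, p ∈ E.space → radialPush R 0 p = p := fun {p} hp => by
    have := norm_ne_zero_iff.2 (ne_zero_of_mem_space hp)
    rw [radialPush, sub_zero, one_mul, zero_mul, add_zero, div_self this, one_smul]
  refine ⟨fun q => g (radialPush R q.1 (f q.2)), ?_, ?_, ?_, ?_, ?_⟩
  · have hcont : ContinuousOn (fun q : ℝ × E3 => radialPush R q.1 (f q.2))
        (Icc 0 1 ×ˢ (B.space \ B.tangle)) := by
      have hf2 : ContinuousOn (fun q : ℝ × E3 => f q.2) (Icc 0 1 ×ˢ (B.space \ B.tangle)) :=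
        hf.continuousOn.comp continuousOn_snd fun q hq => hq.2.1
      unfold radialPush
      refine ContinuousOn.smul (ContinuousOn.div ?_ hf2.norm fun q hq => ?_) hf2
      · exact ((continuousOn_const.sub continuousOn_fst).mul hf2.norm).add
          (continuousOn_fst.mul continuousOn_const)
      · exact norm_ne_zero_iff.2 (ne_zero_of_mem_space (hfm hq.2.1))
    exact hg.continuousOn.comp hcont fun q hq => (hE.radialPush_mem hR hq.1 (hfc hq.2)).1
  · exact fun t ht p hp => hgc (hE.radialPush_mem hR ht (hfc hp))
  · intro p hp
    simp only [hpush (hfm hp.1)]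
    exact hgf hp.1
  · intro p hp
    have hn := norm_radialPush (ne_zero_of_mem_space (hfm hp.1)) hR0 (t := 1) (by simp)
    simp only [sub_self, zero_mul, one_mul, zero_add] at hn
    rw [norm_apply_eq_norm_apply hg hf hgm hfm hfg hgf hR hn rfl, hgf hx₀B, hx₀]
  · intro t ht p hp hpn
    have hn : ‖f p‖ = R := norm_apply_eq_norm_apply hf hg hfm hgm hgf hfg (Or.inl rfl) hpn hx₀
    have h0 : R ≠ 0 := hn ▸ norm_ne_zero_iff.2 (ne_zero_of_mem_space (hfm hp.1))
    have : radialPush R t (f p) = f p := by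
      rw [radialPush, hn, show (1 - t) * R + t * R = R by ring, div_self h0, one_smul]
    simp only [this]
    exact hgf hp.1

end Block

/-! ### The tangle of `A` in cylindrical coordinates -/

/-- Distance from the `z`-axis. -/
noncomputable def axisDist (x : E3) : ℝ := √(x 0 ^ 2 + x 1 ^ 2)

/-- The nonnegative parameter `u` with `tangleHeight u = x 2`, where there is one. -/
noncomputable def foldParam (x : E3) : ℝ := √(1 - 2 * x 2)

/-- Signed horizontal distance of `x` from the surface of revolution swept out by the part `u ≤ 0`
(for `ε = -1`) or `u ≥ 0` (for `ε = 1`) of the tangle. -/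
noncomputable def gap (ε : ℝ) (x : E3) : ℝ := axisDist x - tangleRadius (ε * foldParam x)

/-- Real part of `x` in the horizontal plane turned so that the point of the first component at the
height of `x`, in the part of the tangle given by `ε`, has angle `0`. -/
noncomputable def relRe (ε : ℝ) (x : E3) : ℝ :=
  x 0 * Real.cos (tangleAngle (ε * foldParam x)) + x 1 * Real.sin (tangleAngle (ε * foldParam x))

/-- Imaginary part of `x` in the horizontal plane turned as for `relRe`. -/
noncomputable def relIm (ε : ℝ) (x : E3) : ℝ :=
  x 1 * Real.cos (tangleAngle (ε * foldParam x)) - x 0 * Real.sin (tangleAngle (ε * foldParam x))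

/-- The relative angle of `x` lies strictly between `2πi/3` and `2π(i+1)/3`. -/
def Sector (ε : ℝ) : Fin 3 → E3 → Prop
  | 0, x => 0 < relIm ε x ∧ 0 < relIm ε x + √3 * relRe ε x
  | 1, x => relIm ε x + √3 * relRe ε x < 0 ∧ √3 * relRe ε x < relIm ε x
  | 2, x => relIm ε x < √3 * relRe ε x ∧ relIm ε x < 0

theorem continuous_foldParam : Continuous foldParam := by
  unfold foldParam
  fun_prop

theorem continuous_gap (ε : ℝ) : Continuous (gap ε) := by
  have := continuous_foldParam
  unfold gap axisDist tangleRadius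
  fun_prop

theorem continuous_relRe (ε : ℝ) : Continuous (relRe ε) := by
  have := continuous_foldParam
  unfold relRe tangleAngle
  fun_prop

theorem continuous_relIm (ε : ℝ) : Continuous (relIm ε) := by
  have := continuous_foldParam
  unfold relIm tangleAngle
  fun_prop

theorem isOpen_sector (ε : ℝ) (i : Fin 3) : IsOpen {x | Sector ε i x} := by
  have h1 := continuous_relRe ε
  have h2 := continuous_relIm ε
  have h3 : Continuous fun x => √3 * relRe ε x := by fun_prop
  fin_cases i
  · exact (isOpen_lt continuous_const h2).inter (isOpen_lt continuous_const (h2.add h3))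
  · exact (isOpen_lt (h2.add h3) continuous_const).inter (isOpen_lt h3 h2)
  · exact (isOpen_lt h2 h3).inter (isOpen_lt h2 continuous_const)

theorem Sector.unique {ε : ℝ} {i j : Fin 3} {x : E3} (hi : Sector ε i x) (hj : Sector ε j x) :
    i = j := by
  fin_cases i <;> fin_cases j <;> simp [Sector] at hi hj ⊢ <;> linarith

theorem foldParam_nonneg (x : E3) : 0 ≤ foldParam x := Real.sqrt_nonneg _

theorem foldParam_sq {x : E3} (h : x 2 ≤ 1 / 2) : foldParam x ^ 2 = 1 - 2 * x 2 :=
  Real.sq_sqrt (by linarith)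

/-- The square root of a negative number is `0` by convention. So above height `1/2` both surfaces
of revolution continue as one and the same cylinder of radius `3/2`. -/
theorem foldParam_eq_zero {x : E3} (h : 1 / 2 ≤ x 2) : foldParam x = 0 :=
  Real.sqrt_eq_zero_of_nonpos (by linarith)

theorem foldParam_eq_half {x : E3} (h : x 2 = 3 / 8) : foldParam x = 1 / 2 := by
  have h1 := foldParam_sq (x := x) (by linarith)
  have h2 := foldParam_nonneg x
  nlinarith

/-- The sign of this difference orders the two surfaces at each height. They cross where `foldParam`
is `1/2`, at height `3/8`, and merge where it is `0`, from height `1/2` on. -/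
theorem gap_sub_gap (x : E3) :
    gap (-1) x - gap 1 x = 4 / 3 * foldParam x * (foldParam x ^ 2 - 1 / 4) := by
  unfold gap tangleRadius
  ring

theorem gap_lt_gap_of_lt {x : E3} (h : x 2 < 3 / 8) : gap 1 x < gap (-1) x := by
  have h1 := gap_sub_gap x
  have h2 := foldParam_sq (x := x) (by linarith)
  have h3 : 0 < foldParam x := Real.sqrt_pos.2 (by linarith)
  have h4 : 0 < foldParam x * (foldParam x ^ 2 - 1 / 4) := mul_pos h3 (by linarith)
  linarith

theorem gap_lt_gap_of_gt {x : E3} (h : 3 / 8 < x 2) (h' : x 2 < 1 / 2) :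
    gap (-1) x < gap 1 x := by
  have h1 := gap_sub_gap x
  have h2 := foldParam_sq (x := x) (by linarith)
  have h3 : 0 < foldParam x := Real.sqrt_pos.2 (by linarith)
  have h4 : foldParam x * (foldParam x ^ 2 - 1 / 4) < 0 := mul_neg_of_pos_of_neg h3 (by linarith)
  linarith

theorem gap_eq_gap {x : E3} (h : x 2 = 3 / 8 ∨ 1 / 2 ≤ x 2) : gap (-1) x = gap 1 x := by
  have h1 := gap_sub_gap x
  rcases h with h | h
  · rw [foldParam_eq_half h] at h1
    linarith
  · rw [foldParam_eq_zero h] at h1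
    linarith

theorem gap_le_gap {x : E3} (h : 3 / 8 < x 2) : gap (-1) x ≤ gap 1 x := by
  rcases lt_or_ge (x 2) (1 / 2) with h' | h'
  · exact (gap_lt_gap_of_gt h h').le
  · exact (gap_eq_gap (Or.inr h')).le

theorem eq_or_ge_of_gap_eq {x : E3} (h : gap (-1) x = gap 1 x) : x 2 = 3 / 8 ∨ 1 / 2 ≤ x 2 := by
  by_contra! hc
  rcases lt_or_gt_of_ne hc.1 with h' | h'
  · exact (gap_lt_gap_of_lt h').ne' h
  · exact (gap_lt_gap_of_gt h' hc.2).ne h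

/-- At the height of the double point the two parts of the tangle are half a turn apart. -/
theorem Sector.ne_of_height_eq {x : E3} (h : x 2 = 3 / 8) {i j : Fin 3} (hi : Sector (-1) i x)
    (hj : Sector 1 j x) : i ≠ j := by
  have hs := foldParam_eq_half h
  have a1 : tangleAngle (-1 * foldParam x) = Real.pi := by
    rw [hs, tangleAngle]
    ring
  have a2 : tangleAngle (1 * foldParam x) = 0 := by
    rw [hs, tangleAngle]
    ring
  have e1 : relRe (-1) x = - relRe 1 x := by simp only [relRe, a1, a2]; simp
  have e2 : relIm (-1) x = - relIm 1 x := by simp only [relIm, a1, a2]; simp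
  rintro rfl
  fin_cases i <;> simp [Sector, e1, e2] at hi hj <;> linarith

theorem sector_congr {x : E3} (h : 1 / 2 ≤ x 2) (i : Fin 3) : Sector (-1) i x ↔ Sector 1 i x := by
  have e1 : relRe (-1) x = relRe 1 x := by simp only [relRe, foldParam_eq_zero h, mul_zero]
  have e2 : relIm (-1) x = relIm 1 x := by simp only [relIm, foldParam_eq_zero h, mul_zero]
  fin_cases i <;> simp [Sector, e1, e2]

theorem axisDist_sq (x : E3) : axisDist x ^ 2 = x 0 ^ 2 + x 1 ^ 2 :=
  Real.sq_sqrt (by positivity)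

theorem norm_sq_eq_axisDist_sq (x : E3) : ‖x‖ ^ 2 = axisDist x ^ 2 + x 2 ^ 2 := by
  rw [EuclideanSpace.norm_sq_eq, axisDist_sq]
  simp [Fin.sum_univ_three]

theorem one_le_sq_of_mem {x : E3} (hx : x ∈ blockA.space) : 1 ≤ axisDist x ^ 2 + x 2 ^ 2 := by
  have h : 1 ≤ ‖x‖ := hx.1
  rw [← norm_sq_eq_axisDist_sq]
  nlinarith

theorem sq_le_four_of_mem {x : E3} (hx : x ∈ blockA.space) : axisDist x ^ 2 + x 2 ^ 2 ≤ 4 := by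
  have h : ‖x‖ ≤ 2 := hx.2
  have h0 := norm_nonneg x
  rw [← norm_sq_eq_axisDist_sq]
  nlinarith

/-- Inside the thickened sphere the surfaces of revolution do not go below the `xy`-plane. -/
theorem height_nonneg {x : E3} (hx : x ∈ blockA.space) {ε : ℝ} (hε : ε = -1 ∨ ε = 1)
    (hg : gap ε x = 0) : 0 ≤ x 2 := by
  by_contra! hneg
  have hs := foldParam_sq (x := x) (by linarith)
  have hs0 := foldParam_nonneg x
  have h1 := one_le_sq_of_mem hx
  have h4 := sq_le_four_of_mem hx
  have hr0 : 0 ≤ axisDist x := Real.sqrt_nonneg _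
  have hz : x 2 = (1 - foldParam x ^ 2) / 2 := by linarith
  unfold gap at hg
  set s := foldParam x
  set r := axisDist x
  have hs1 : 1 < s := by nlinarith
  rcases hε with rfl | rfl
  -- Below the plane this surface is too close to the origin: `r ≥ 0` bounds `s`, which gives `z² <
  -- s - 1 < (s - 1) q = 1 - r`. With `r² ≤ r` this yields `r² + z² < 1`.
  · have hr : r = 1 - (s - 1) * (2 / 3 * s ^ 2 + 2 / 3 * s + 1 / 2) := by
      have := tangleRadius_sub_one (-1 * s)
      linarith
    set q := 2 / 3 * s ^ 2 + 2 / 3 * s + 1 / 2 with hq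
    have hq1 : 11 / 6 < q := by nlinarith
    have he : (s - 1) * q ≤ 1 := by linarith
    have hs2 : s < 17 / 11 := by nlinarith
    have hz2 : x 2 ^ 2 = (s - 1) * ((s - 1) * (s + 1) ^ 2 / 4) := by rw [hz]; ring
    have hb : (s - 1) * (s + 1) ^ 2 / 4 < 1 := by
      have : (s + 1) ^ 2 ≤ 7 := by nlinarith
      nlinarith
    have hpos : 0 < s - 1 := by linarith
    have hz3 : x 2 ^ 2 < s - 1 := by
      rw [hz2]
      nlinarith
    have hp : 0 < (s - 1) * (q - 1) := mul_pos hpos (by linarith)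
    have hr1 : r * r ≤ r * 1 := mul_le_mul_of_nonneg_left (by linarith) hr0
    linarith
  -- The other surface leaves the outer sphere at the equator.
  · have hr : r = 2 + (s - 1) * (2 / 3 * s ^ 2 + 2 / 3 * s + 1 / 2) := by
      have := two_sub_tangleRadius (1 * s)
      linarith
    have hp : 0 < (s - 1) * (2 / 3 * s ^ 2 + 2 / 3 * s + 1 / 2) :=
      mul_pos (by linarith) (by positivity)
    have hr2 : 2 < r := by linarith
    have hr4 : 2 * 2 < r * r := mul_self_lt_mul_self (by norm_num) hr2
    linarith [sq_nonneg (x 2)]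

theorem tangleCurve_zero (k : Fin 3) (u : ℝ) : tangleCurve k u 0 =
    tangleRadius u * Real.cos (tangleAngle u + 2 * Real.pi * (k : ℝ) / 3) := rfl

theorem tangleCurve_one (k : Fin 3) (u : ℝ) : tangleCurve k u 1 =
    tangleRadius u * Real.sin (tangleAngle u + 2 * Real.pi * (k : ℝ) / 3) := rfl

theorem tangleCurve_two (k : Fin 3) (u : ℝ) : tangleCurve k u 2 = tangleHeight u := rfl

theorem tangleCurve_mem {k : Fin 3} {u : ℝ} (hu : u ∈ Icc (-1 : ℝ) 1) :
    tangleCurve k u ∈ blockA.tangle := by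
  refine mem_iUnion.2 ⟨k, (u + 1) / 2, ⟨by linarith [hu.1], by linarith [hu.2]⟩, ?_⟩
  rw [tangleArc]
  congr 1
  ring

theorem cos_two_pi_div_three : Real.cos (2 * Real.pi / 3) = -1 / 2 := by
  rw [show 2 * Real.pi / 3 = Real.pi - Real.pi / 3 by ring, Real.cos_pi_sub, Real.cos_pi_div_three]
  ring

theorem sin_two_pi_div_three : Real.sin (2 * Real.pi / 3) = √3 / 2 := by
  rw [show 2 * Real.pi / 3 = Real.pi - Real.pi / 3 by ring, Real.sin_pi_sub, Real.sin_pi_div_three]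

theorem cos_four_pi_div_three : Real.cos (2 * Real.pi * 2 / 3) = -1 / 2 := by
  rw [show 2 * Real.pi * 2 / 3 = Real.pi / 3 + Real.pi by ring, Real.cos_add_pi,
    Real.cos_pi_div_three]
  ring

theorem sin_four_pi_div_three : Real.sin (2 * Real.pi * 2 / 3) = -(√3 / 2) := by
  rw [show 2 * Real.pi * 2 / 3 = Real.pi / 3 + Real.pi by ring, Real.sin_add_pi,
    Real.sin_pi_div_three]

/-- Points of the surfaces of revolution in no open sector lie on the tangle. -/
theorem exists_sector {x : E3} (hx : x ∈ blockA.space \ blockA.tangle) {ε : ℝ}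
    (hε : ε = -1 ∨ ε = 1) (hg : gap ε x = 0) (hz : x 2 ≤ 1 / 2) : ∃ i, Sector ε i x := by
  by_contra! hno
  refine hx.2 ?_
  have hz0 := height_nonneg hx.1 hε hg
  have hs := foldParam_sq hz
  have hs0 := foldParam_nonneg x
  have hs1 : foldParam x ≤ 1 := by nlinarith
  set u := ε * foldParam x with hu
  have huI : u ∈ Icc (-1 : ℝ) 1 := by
    rcases hε with rfl | rfl <;> constructor <;> linarith
  have hu2 : u ^ 2 = 1 - 2 * x 2 := by
    rcases hε with rfl | rfl <;> rw [← hs, hu] <;> ring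
  have hr : axisDist x = tangleRadius u := by
    unfold gap at hg
    linarith
  have hrpos : 0 < tangleRadius u := tangleRadius_pos huI.1
  have hr2 := axisDist_sq x
  rw [hr] at hr2
  set c := Real.cos (tangleAngle u) with hc
  set d := Real.sin (tangleAngle u) with hd
  have hcd : d ^ 2 + c ^ 2 = 1 := Real.sin_sq_add_cos_sq _
  set b := relRe ε x with hb
  set a := relIm ε x with ha
  have hb' : b = x 0 * c + x 1 * d := rfl
  have ha' : a = x 1 * c - x 0 * d := rfl
  have hab : a ^ 2 + b ^ 2 = tangleRadius u ^ 2 := by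
    rw [ha', hb']
    linear_combination (x 0 ^ 2 + x 1 ^ 2) * hcd - hr2
  have hx0 : x 0 = b * c - a * d := by
    rw [ha', hb']
    linear_combination -x 0 * hcd
  have hx1 : x 1 = b * d + a * c := by
    rw [ha', hb']
    linear_combination -x 1 * hcd
  have h3 : √3 ^ 2 = 3 := Real.sq_sqrt (by norm_num)
  have h3pos : 0 < √3 := Real.sqrt_pos.2 (by norm_num)
  suffices hk : ∃ k : Fin 3, b = tangleRadius u * Real.cos (2 * Real.pi * (k : ℝ) / 3) ∧
      a = tangleRadius u * Real.sin (2 * Real.pi * (k : ℝ) / 3) by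
    obtain ⟨k, hkb, hka⟩ := hk
    have : x = tangleCurve k u := by
      ext i
      fin_cases i
      · change x 0 = tangleCurve k u 0
        rw [tangleCurve_zero, Real.cos_add, hx0, hkb, hka]
        ring
      · change x 1 = tangleCurve k u 1
        rw [tangleCurve_one, Real.sin_add, hx1, hkb, hka]
        ring
      · change x 2 = tangleCurve k u 2
        rw [tangleCurve_two, tangleHeight, hu2]
        ring
    rw [this]
    exact tangleCurve_mem huI
  have n0 : ¬ (0 < a ∧ 0 < a + √3 * b) := hno 0
  have n1 : ¬ (a + √3 * b < 0 ∧ √3 * b < a) := hno 1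
  have n2 : ¬ (a < √3 * b ∧ a < 0) := hno 2
  -- Outside the open sectors remain the three rays at angles `0`, `2π/3`, `4π/3`, told apart by the
  -- sign of `a`. On the last two `a = ∓√3 b`, and `a² + b² = r²` gives `b = -r/2`.
  rcases lt_trichotomy a 0 with h | h | h
  · have h5 : √3 * b ≤ a := not_lt.1 fun h' => n2 ⟨h', h⟩
    have h6 : √3 * b = a := le_antisymm h5 (not_lt.1 fun h' => n1 ⟨by linarith, h'⟩)
    have hbneg : b < 0 := by nlinarith
    have hb2 : (2 * b) ^ 2 = tangleRadius u ^ 2 := by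
      rw [← hab, ← h6]
      linear_combination (-b ^ 2) * h3
    have hb3 : b = -(tangleRadius u / 2) := by
      have := (sq_eq_sq₀ (show 0 ≤ -(2 * b) by linarith) hrpos.le).1 (by rw [neg_sq, hb2])
      linarith
    refine ⟨2, ?_, ?_⟩
    · simp only [Fin.val_two, Nat.cast_ofNat]
      rw [cos_four_pi_div_three, hb3]
      ring
    · simp only [Fin.val_two, Nat.cast_ofNat]
      rw [sin_four_pi_div_three, ← h6, hb3]
      ring
  · have h7 : 0 ≤ b := by
      by_contra! hb0
      have := mul_neg_of_pos_of_neg h3pos hb0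
      exact n1 ⟨by linarith, by linarith⟩
    refine ⟨0, ?_, by simp [h]⟩
    rw [h, zero_pow two_ne_zero, zero_add] at hab
    simpa using (sq_eq_sq₀ h7 hrpos.le).1 hab
  · have h5 : a + √3 * b ≤ 0 := not_lt.1 fun h' => n0 ⟨h, h'⟩
    have h6 : a = -(√3 * b) := by
      have : 0 ≤ a + √3 * b := not_lt.1 fun h' => n1 ⟨h', by linarith⟩
      linarith
    have hbneg : b < 0 := by nlinarith
    have hb2 : (2 * b) ^ 2 = tangleRadius u ^ 2 := by
      rw [← hab, h6]
      linear_combination (-b ^ 2) * h3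
    have hb3 : b = -(tangleRadius u / 2) := by
      have := (sq_eq_sq₀ (show 0 ≤ -(2 * b) by linarith) hrpos.le).1 (by rw [neg_sq, hb2])
      linarith
    refine ⟨1, ?_, ?_⟩
    · simp only [Fin.val_one, Nat.cast_one, mul_one]
      rw [cos_two_pi_div_three, hb3]
      ring
    · simp only [Fin.val_one, Nat.cast_one, mul_one]
      rw [sin_two_pi_div_three, h6, hb3]
      ring

/-- Points of the tangle lie on one of the surfaces of revolution and in no open sector. -/
theorem exists_gap_eq_zero_of_mem_tangle {x : E3} (hx : x ∈ blockA.tangle) :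
    ∃ ε : ℝ, (ε = -1 ∨ ε = 1) ∧ gap ε x = 0 ∧ x 2 ≤ 1 / 2 ∧ ∀ i, ¬ Sector ε i x := by
  obtain ⟨k, t, ht, rfl⟩ := mem_iUnion.1 hx
  have hu : 2 * t - 1 ∈ Icc (-1 : ℝ) 1 := ⟨by linarith [ht.1], by linarith [ht.2]⟩
  rw [tangleArc]
  set u := 2 * t - 1
  have hz : tangleCurve k u 2 = (1 - u ^ 2) / 2 := rfl
  have hfold : foldParam (tangleCurve k u) = |u| := by
    rw [foldParam, hz, show 1 - 2 * ((1 - u ^ 2) / 2) = u ^ 2 by ring, Real.sqrt_sq_eq_abs]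
  have hrpos : 0 < tangleRadius u := tangleRadius_pos hu.1
  have hr : axisDist (tangleCurve k u) = tangleRadius u := by
    rw [axisDist, tangleCurve_zero, tangleCurve_one, mul_pow, mul_pow, ← mul_add,
      Real.cos_sq_add_sin_sq, mul_one, Real.sqrt_sq hrpos.le]
  obtain ⟨ε, hε, hεu⟩ : ∃ ε : ℝ, (ε = -1 ∨ ε = 1) ∧ ε * |u| = u := by
    rcases le_total 0 u with h | h
    · exact ⟨1, Or.inr rfl, by rw [abs_of_nonneg h, one_mul]⟩
    · exact ⟨-1, Or.inl rfl, by rw [abs_of_nonpos h]; ring⟩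
  refine ⟨ε, hε, ?_, ?_, ?_⟩
  · rw [gap, hfold, hεu, hr, sub_self]
  · rw [hz]
    nlinarith [sq_nonneg u]
  have hb : relRe ε (tangleCurve k u) =
      tangleRadius u * Real.cos (2 * Real.pi * (k : ℝ) / 3) := by
    rw [relRe, hfold, hεu, tangleCurve_zero, tangleCurve_one, Real.cos_add, Real.sin_add]
    linear_combination tangleRadius u * Real.cos (2 * Real.pi * (k : ℝ) / 3) *
      Real.sin_sq_add_cos_sq (tangleAngle u)
  have ha : relIm ε (tangleCurve k u) =
      tangleRadius u * Real.sin (2 * Real.pi * (k : ℝ) / 3) := by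
    rw [relIm, hfold, hεu, tangleCurve_zero, tangleCurve_one, Real.cos_add, Real.sin_add]
    linear_combination tangleRadius u * Real.sin (2 * Real.pi * (k : ℝ) / 3) *
      Real.sin_sq_add_cos_sq (tangleAngle u)
  have hq : √3 * tangleRadius u > 0 := by positivity
  intro i hi
  have hk : k = 0 ∨ k = 1 ∨ k = 2 := by
    fin_cases k <;> simp
  set a := relIm ε (tangleCurve k u) with haeq
  set b := √3 * relRe ε (tangleCurve k u) with hbeq
  suffices h : a = 0 ∧ 0 < b ∨ 0 < a ∧ a + b = 0 ∨ a < 0 ∧ b = a by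
    have hi' : 0 < a ∧ 0 < a + b ∨ a + b < 0 ∧ b < a ∨ a < b ∧ a < 0 := by
      fin_cases i
      · exact Or.inl hi
      · exact Or.inr (Or.inl hi)
      · exact Or.inr (Or.inr hi)
    rcases h with h | h | h <;> rcases hi' with hi' | hi' | hi' <;> linarith [h.1, h.2, hi'.1, hi'.2]
  rw [hb] at hbeq
  rcases hk with rfl | rfl | rfl
  · left
    simp only [Fin.val_zero, Nat.cast_zero, mul_zero, zero_div, Real.cos_zero, Real.sin_zero,
      mul_one] at hbeq ha
    exact ⟨ha, hbeq ▸ hq⟩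
  · right; left
    simp only [Fin.val_one, Nat.cast_one, mul_one, cos_two_pi_div_three,
      sin_two_pi_div_three] at hbeq ha
    constructor <;> linarith
  · right; right
    simp only [Fin.val_two, Nat.cast_ofNat, cos_four_pi_div_three,
      sin_four_pi_div_three] at hbeq ha
    constructor <;> linarith

/-- The surfaces of revolution meet the inner sphere only in the equator, and only in the part
given by `ε = -1`. -/
theorem eq_of_norm_eq_one {x : E3} (hx : ‖x‖ = 1) {ε : ℝ} (hε : ε = -1 ∨ ε = 1)
    (hg : gap ε x = 0) (hz : x 2 ≤ 1 / 2) : ε = -1 ∧ x 2 = 0 := by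
  have hxA : x ∈ blockA.space := ⟨hx.ge, by rw [hx]; exact one_le_two⟩
  have hz0 := height_nonneg hxA hε hg
  have hs := foldParam_sq hz
  have hs0 := foldParam_nonneg x
  have hs1 : foldParam x ≤ 1 := by nlinarith
  have hn := norm_sq_eq_axisDist_sq x
  rw [hx] at hn
  unfold gap at hg
  set s := foldParam x
  have hq1 : 0 < 2 / 3 * s ^ 2 + 2 / 3 * s + 1 / 2 := by positivity
  have hq2 : 0 < 2 / 3 * s ^ 2 - 2 / 3 * s + 1 / 2 := by nlinarith [sq_nonneg (s - 1 / 2)]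
  rcases hε with rfl | rfl
  · have hr : axisDist x = 1 + (1 - s) * (2 / 3 * s ^ 2 + 2 / 3 * s + 1 / 2) := by
      have := tangleRadius_sub_one (-1 * s)
      linarith
    have : 0 ≤ (1 - s) * (2 / 3 * s ^ 2 + 2 / 3 * s + 1 / 2) :=
      mul_nonneg (by linarith) hq1.le
    refine ⟨rfl, ?_⟩
    nlinarith
  · have hr : axisDist x = 1 + (1 + s) * (2 / 3 * s ^ 2 - 2 / 3 * s + 1 / 2) := by
      have := tangleRadius_sub_one (1 * s)
      linarith
    have : 0 < (1 + s) * (2 / 3 * s ^ 2 - 2 / 3 * s + 1 / 2) := by positivity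
    nlinarith [sq_nonneg (x 2)]

/-! ### A fourfold covering of the complement of the tangle of `A`

Off the two surfaces of revolution the covering is trivial. The fibre is the field with four
elements, and its monodromy consists of affine maps. -/

/-- The additive group of the field with four elements. -/
abbrev FieldFour : Type := ZMod 2 × ZMod 2

/-- Multiplication by a primitive third root of unity `ω`; here `1 = (1, 0)` and `ω = (0, 1)`. -/
def mulOmega : Equiv.Perm FieldFour where
  toFun p := (p.2, p.1 + p.2)
  invFun p := (p.1 + p.2, p.1)
  left_inv := by decide
  right_inv := by decide

/-- `y ↦ ωⁱ y`, for crossing the inner part of the tangle upwards. -/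
def innerWall (i : Fin 3) : Equiv.Perm FieldFour := mulOmega ^ (i : ℕ)

/-- `y ↦ ωⁱ y + ω²ⁱ`, for crossing into the loop of the tangle. -/
def loopWall (i : Fin 3) : Equiv.Perm FieldFour :=
  Equiv.addRight ((mulOmega ^ (2 * (i : ℕ))) (1, 0)) * mulOmega ^ (i : ℕ)

/-- `y ↦ ωⁱ (y + 1)`, for crossing the outer part of the tangle upwards. -/
def outerWall (i : Fin 3) : Equiv.Perm FieldFour := mulOmega ^ (i : ℕ) * Equiv.addRight (1, 0)

/-- This is the triviality of the monodromy around the circle of double points. Both sides have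
linear part `ωⁱ⁺ʲ`, and the constants agree because `ω²ⁱ + ω²ʲ = (ωⁱ + ωʲ)² = ωⁱ⁺ʲ`: for `i ≠ j` the
sum `ωⁱ + ωʲ` is the third power of `ω`, and the three powers have product `1`. -/
theorem loopWall_mul_innerWall {i j : Fin 3} (h : i ≠ j) :
    loopWall j * innerWall i = loopWall i * outerWall j := by
  revert i j
  decide

theorem innerWall_zero (i : Fin 3) : innerWall i 0 = 0 := by
  revert i
  decide

theorem outerWall_zero_apply : outerWall 0 (1, 0) = 0 := by decide

/-- `τ a b` is to identify the fibre with `FieldFour` on the side of the two surfaces given by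
the signs `a` and `b` of the gaps. The conditions say that `τ` is compatible at `x` with the
walls through `x`. -/
structure IsGaugeAt (τ : Bool → Bool → Equiv.Perm FieldFour) (x : E3) : Prop where
  inner : ∀ i, Sector (-1) i x → gap (-1) x = 0 → x 2 ≤ 3 / 8 →
    τ true false = τ false false * innerWall i
  loop_right : ∀ i, Sector (-1) i x → gap (-1) x = 0 → 3 / 8 ≤ x 2 → x 2 ≤ 1 / 2 →
    τ true true = τ false true * loopWall i
  outer : ∀ i, Sector 1 i x → gap 1 x = 0 → x 2 ≤ 3 / 8 →
    τ true false = τ true true * outerWall i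
  loop_left : ∀ i, Sector 1 i x → gap 1 x = 0 → 3 / 8 ≤ x 2 → x 2 ≤ 1 / 2 →
    τ false false = τ false true * loopWall i
  top : gap (-1) x = 0 → 1 / 2 ≤ x 2 → τ false false = τ true true

open Classical in
/-- The value of `τ` on the side of the two surfaces on which `x` lies. -/
noncomputable def gaugeValue (τ : Bool → Bool → Equiv.Perm FieldFour) (x : E3) :
    Equiv.Perm FieldFour :=
  τ (decide (0 < gap (-1) x)) (decide (0 < gap 1 x))

open Classical in
theorem eventually_decide_gap {ε : ℝ} {x : E3} (h : gap ε x ≠ 0) :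
    ∀ᶠ y in 𝓝 x, decide (0 < gap ε y) = decide (0 < gap ε x) := by
  rcases lt_or_gt_of_ne h with h | h
  · filter_upwards [(continuous_gap ε).continuousAt.eventually (gt_mem_nhds h)] with y hy
    simp [h.not_gt, hy.not_gt]
  · filter_upwards [(continuous_gap ε).continuousAt.eventually (lt_mem_nhds h)] with y hy
    simp [h, hy]

theorem continuous_height : Continuous fun x : E3 => x 2 := by fun_prop

-- Two gauges at `x` satisfy the same relations, `a = b w` and `a' = b' w`, so the wall permutation
-- `w` cancels from the quotient `a' a⁻¹`. The quotient is therefore the same on all sides of the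
-- walls that occur near `x`.
open Classical in
theorem eventually_gaugeValue_mul_inv {τ τ' : Bool → Bool → Equiv.Perm FieldFour} {x : E3}
    (hx : x ∈ blockA.space \ blockA.tangle) (h : IsGaugeAt τ x) (h' : IsGaugeAt τ' x) :
    ∀ᶠ y in 𝓝 x, gaugeValue τ' y * (gaugeValue τ y)⁻¹ = gaugeValue τ' x * (gaugeValue τ x)⁻¹ := by
  have quot : ∀ {a b a' b' w : Equiv.Perm FieldFour}, a = b * w → a' = b' * w →
      a' * a⁻¹ = b' * b⁻¹ := by
    rintro a b a' b' w rfl rfl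
    group
  set D : Bool → Bool → Equiv.Perm FieldFour := fun a b => τ' a b * (τ a b)⁻¹ with hD
  change ∀ᶠ y in 𝓝 x, D (decide (0 < gap (-1) y)) (decide (0 < gap 1 y)) =
    D (decide (0 < gap (-1) x)) (decide (0 < gap 1 x))
  have hlow : ∀ i, Sector (-1) i x → gap (-1) x = 0 → x 2 ≤ 3 / 8 →
      D true false = D false false := fun i a b c => quot (h.inner i a b c) (h'.inner i a b c)
  have hright : ∀ i, Sector (-1) i x → gap (-1) x = 0 → 3 / 8 ≤ x 2 → x 2 ≤ 1 / 2 →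
      D true true = D false true := fun i a b c d =>
    quot (h.loop_right i a b c d) (h'.loop_right i a b c d)
  have hout : ∀ i, Sector 1 i x → gap 1 x = 0 → x 2 ≤ 3 / 8 →
      D true false = D true true := fun i a b c => quot (h.outer i a b c) (h'.outer i a b c)
  have hleft : ∀ i, Sector 1 i x → gap 1 x = 0 → 3 / 8 ≤ x 2 → x 2 ≤ 1 / 2 →
      D false false = D false true := fun i a b c d =>
    quot (h.loop_left i a b c d) (h'.loop_left i a b c d)
  have htop : gap (-1) x = 0 → 1 / 2 ≤ x 2 → D false false = D true true := fun a b => by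
    rw [hD]
    simp only [h.top a b, h'.top a b]
  by_cases g1 : gap (-1) x = 0 <;> by_cases g2 : gap 1 x = 0
  · rcases eq_or_ge_of_gap_eq (g1.trans g2.symm) with hz | hz
    · obtain ⟨i, hi⟩ := exists_sector hx (Or.inl rfl) g1 (by linarith)
      obtain ⟨j, hj⟩ := exists_sector hx (Or.inr rfl) g2 (by linarith)
      have e1 := hlow i hi g1 hz.le
      have e2 := hright i hi g1 hz.ge (by linarith)
      have e3 := hout j hj g2 hz.le
      -- At a double point all four regions meet; three of the four walls already link them.
      have hall : ∀ a b, D a b = D false false := by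
        rintro (_ | _) (_ | _)
        · rfl
        · rw [← e2, ← e3, e1]
        · exact e1
        · rw [← e3, e1]
      exact Filter.Eventually.of_forall fun y => by rw [hall, hall (decide _)]
    · have e1 := htop g1 hz
      rcases hz.eq_or_lt with hz' | hz'
      · obtain ⟨i, hi⟩ := exists_sector hx (Or.inl rfl) g1 hz'.ge
        have e2 := hright i hi g1 (by linarith) hz'.ge
        -- Above the double points the region with signs `true false` is empty, so the other three
        -- suffice.
        have hall : ∀ y : E3, 3 / 8 < y 2 →
            D (decide (0 < gap (-1) y)) (decide (0 < gap 1 y)) = D true true := by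
          intro y hy
          have hle := gap_le_gap hy
          by_cases a : 0 < gap (-1) y
          · simp [a, a.trans_le hle]
          · by_cases b : 0 < gap 1 y
            · simp [a, b, e2]
            · simp [a, b, e1]
        filter_upwards [continuous_height.continuousAt.eventually
          (lt_mem_nhds (show 3 / 8 < x 2 by linarith))] with y hy
        rw [hall y hy, hall x (by linarith)]
      · have hall : ∀ y : E3, 1 / 2 < y 2 →
            D (decide (0 < gap (-1) y)) (decide (0 < gap 1 y)) = D true true := by
          intro y hy
          rw [gap_eq_gap (Or.inr hy.le)]
          by_cases b : 0 < gap 1 y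
          · simp [b]
          · simp [b, e1]
        filter_upwards [continuous_height.continuousAt.eventually (lt_mem_nhds hz')] with y hy
        rw [hall y hy, hall x hz']
  · have hz : x 2 < 1 / 2 := by
      by_contra! hz
      exact g2 ((gap_eq_gap (Or.inr hz)).symm.trans g1)
    obtain ⟨i, hi⟩ := exists_sector hx (Or.inl rfl) g1 hz.le
    filter_upwards [eventually_decide_gap g2] with y hy
    rw [hy]
    -- The height decides on which side of the other surface `x` lies, hence which wall it is on.
    rcases lt_trichotomy (x 2) (3 / 8) with hz' | hz' | hz'
    · have e1 := hlow i hi g1 hz'.le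
      have b : ¬ 0 < gap 1 x := by linarith [gap_lt_gap_of_lt hz']
      have hall : ∀ a, D a false = D false false := by
        rintro (_ | _)
        exacts [rfl, e1]
      simp only [b, decide_false]
      rw [hall, hall (decide _)]
    · exact absurd ((gap_eq_gap (Or.inl hz')).symm.trans g1) g2
    · have e1 := hright i hi g1 hz'.le hz.le
      have b : 0 < gap 1 x := by linarith [gap_lt_gap_of_gt hz' hz]
      have hall : ∀ a, D a true = D false true := by
        rintro (_ | _)
        exacts [rfl, e1]
      simp only [b, decide_true]
      rw [hall, hall (decide _)]
  · have hz : x 2 < 1 / 2 := by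
      by_contra! hz
      exact g1 ((gap_eq_gap (Or.inr hz)).trans g2)
    obtain ⟨i, hi⟩ := exists_sector hx (Or.inr rfl) g2 hz.le
    filter_upwards [eventually_decide_gap g1] with y hy
    rw [hy]
    rcases lt_trichotomy (x 2) (3 / 8) with hz' | hz' | hz'
    · have e1 := hout i hi g2 hz'.le
      have b : 0 < gap (-1) x := by linarith [gap_lt_gap_of_lt hz']
      have hall : ∀ a, D true a = D true true := by
        rintro (_ | _)
        exacts [e1, rfl]
      simp only [b, decide_true]
      rw [hall, hall (decide _)]
    · exact absurd ((gap_eq_gap (Or.inl hz')).trans g2) g1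
    · have e1 := hleft i hi g2 hz'.le hz.le
      have b : ¬ 0 < gap (-1) x := by linarith [gap_lt_gap_of_gt hz' hz]
      have hall : ∀ a, D false a = D false true := by
        rintro (_ | _)
        exacts [e1, rfl]
      simp only [b, decide_false]
      rw [hall, hall (decide _)]
  · filter_upwards [eventually_decide_gap g1, eventually_decide_gap g2] with y h1 h2
    rw [h1, h2]

/-! ### Charts of the covering -/

/-- An open set with a gauge on it. -/
structure GaugeChart where
  source : Set E3
  gauge : Bool → Bool → Equiv.Perm FieldFour
  isOpen_source : IsOpen source
  isGaugeAt : ∀ x ∈ source, IsGaugeAt gauge x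

theorem isOpen_gap_ne (ε : ℝ) : IsOpen {x | gap ε x ≠ 0} :=
  isOpen_ne_fun (continuous_gap ε) continuous_const

namespace GaugeChart

/-- The chart away from the walls. -/
def offWalls : GaugeChart where
  source := {x | gap (-1) x ≠ 0 ∧ gap 1 x ≠ 0 ∨ 1 / 2 < x 2}
  gauge _ _ := 1
  isOpen_source := ((isOpen_gap_ne _).inter (isOpen_gap_ne _)).union
    (isOpen_lt continuous_const continuous_height)
  isGaugeAt x hx := by
    constructor
    · intro i _ h0 h1
      rcases hx with hx | hx
      exacts [absurd h0 hx.1, by linarith]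
    · intro i _ h0 _ h1
      rcases hx with hx | hx
      exacts [absurd h0 hx.1, by linarith]
    · intro i _ h0 h1
      rcases hx with hx | hx
      exacts [absurd h0 hx.2, by linarith]
    · intro i _ h0 _ h1
      rcases hx with hx | hx
      exacts [absurd h0 hx.2, by linarith]
    · intro _ _
      rfl

/-- The charts around the inner part of the tangle. -/
def inner (i : Fin 3) : GaugeChart where
  source := {x | Sector (-1) i x ∧ gap 1 x ≠ 0 ∧ x 2 < 3 / 8}
  gauge a _ := if a then innerWall i else 1
  isOpen_source := (isOpen_sector _ i).inter ((isOpen_gap_ne _).inter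
    (isOpen_lt continuous_height continuous_const))
  isGaugeAt x hx := by
    obtain ⟨h1, h2, h3⟩ := hx
    constructor
    · intro j hj _ _
      rw [h1.unique hj]
      simp
    · intro j _ _ h _
      linarith
    · intro j _ h _
      exact absurd h h2
    · intro j _ h _ _
      exact absurd h h2
    · intro _ h
      linarith

/-- The charts around the outer part of the tangle. -/
def outer (i : Fin 3) : GaugeChart where
  source := {x | Sector 1 i x ∧ gap (-1) x ≠ 0 ∧ x 2 < 3 / 8}
  gauge _ b := if b then 1 else outerWall i
  isOpen_source := (isOpen_sector _ i).inter ((isOpen_gap_ne _).inter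
    (isOpen_lt continuous_height continuous_const))
  isGaugeAt x hx := by
    obtain ⟨h1, h2, h3⟩ := hx
    constructor
    · intro j _ h _
      exact absurd h h2
    · intro j _ h _ _
      exact absurd h h2
    · intro j hj _ _
      rw [h1.unique hj]
      simp
    · intro j _ _ h _
      linarith
    · intro h _
      exact absurd h h2

/-- The charts around the right part of the loop. -/
def loopRight (i : Fin 3) : GaugeChart where
  source := {x | Sector (-1) i x ∧ gap 1 x ≠ 0 ∧ 3 / 8 < x 2 ∧ x 2 < 1 / 2}
  gauge a _ := if a then loopWall i else 1
  isOpen_source := (isOpen_sector _ i).inter ((isOpen_gap_ne _).inter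
    ((isOpen_lt continuous_const continuous_height).inter
      (isOpen_lt continuous_height continuous_const)))
  isGaugeAt x hx := by
    obtain ⟨h1, h2, h3, h4⟩ := hx
    constructor
    · intro j _ _ h
      linarith
    · intro j hj _ _ _
      rw [h1.unique hj]
      simp
    · intro j _ h _
      exact absurd h h2
    · intro j _ h _ _
      exact absurd h h2
    · intro _ h
      linarith

/-- The charts around the left part of the loop. -/
def loopLeft (i : Fin 3) : GaugeChart where
  source := {x | Sector 1 i x ∧ gap (-1) x ≠ 0 ∧ 3 / 8 < x 2 ∧ x 2 < 1 / 2}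
  gauge _ b := if b then 1 else loopWall i
  isOpen_source := (isOpen_sector _ i).inter ((isOpen_gap_ne _).inter
    ((isOpen_lt continuous_const continuous_height).inter
      (isOpen_lt continuous_height continuous_const)))
  isGaugeAt x hx := by
    obtain ⟨h1, h2, h3, h4⟩ := hx
    constructor
    · intro j _ h _
      exact absurd h h2
    · intro j _ h _ _
      exact absurd h h2
    · intro j _ _ h
      linarith
    · intro j hj _ _ _
      rw [h1.unique hj]
      simp
    · intro h _
      exact absurd h h2

/-- The charts around the circle of highest points of the loop. -/
def apex (i : Fin 3) : GaugeChart where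
  source := {x | Sector (-1) i x ∧ Sector 1 i x ∧ 3 / 8 < x 2}
  gauge a b := if !a && b then 1 else loopWall i
  isOpen_source := (isOpen_sector _ i).inter ((isOpen_sector _ i).inter
    (isOpen_lt continuous_const continuous_height))
  isGaugeAt x hx := by
    obtain ⟨h1, h2, h3⟩ := hx
    constructor
    · intro j _ _ h
      linarith
    · intro j hj _ _ _
      rw [h1.unique hj]
      simp
    · intro j _ _ h
      linarith
    · intro j hj _ _ _
      rw [h2.unique hj]
      simp
    · intro _ _
      simp

/-- The charts around the circle of double points. -/
def crossing (i j : Fin 3) (hij : i ≠ j) : GaugeChart where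
  source := {x | Sector (-1) i x ∧ Sector 1 j x ∧ x 2 < 1 / 2}
  gauge a b := (if b then (loopWall j)⁻¹ else 1) *
    (if a then (if b then loopWall i else innerWall i) else 1)
  isOpen_source := (isOpen_sector _ i).inter ((isOpen_sector _ j).inter
    (isOpen_lt continuous_height continuous_const))
  isGaugeAt x hx := by
    obtain ⟨h1, h2, h3⟩ := hx
    constructor
    · intro k hk _ _
      rw [h1.unique hk]
      simp
    · intro k hk _ _ _
      rw [h1.unique hk]
      simp
    · intro k hk _ _
      rw [← h2.unique hk]
      simp only [if_true, Bool.false_eq_true, if_false, one_mul]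
      -- The gauge is built to satisfy the other three wall conditions; the fourth is the relation
      -- around the double points and needs `i ≠ j`.
      rw [mul_assoc, ← loopWall_mul_innerWall hij, inv_mul_cancel_left]
    · intro k hk _ _ _
      rw [h2.unique hk]
      simp
    · intro _ h
      linarith

theorem exists_mem_source {x : E3} (hx : x ∈ blockA.space \ blockA.tangle) :
    ∃ c : GaugeChart, x ∈ c.source := by
  rcases lt_or_ge (1 / 2) (x 2) with hz | hz
  · exact ⟨offWalls, Or.inr hz⟩
  by_cases g1 : gap (-1) x = 0 <;> by_cases g2 : gap 1 x = 0
  · obtain ⟨i, hi⟩ := exists_sector hx (Or.inl rfl) g1 hz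
    obtain ⟨j, hj⟩ := exists_sector hx (Or.inr rfl) g2 hz
    rcases eq_or_ge_of_gap_eq (g1.trans g2.symm) with hz' | hz'
    · exact ⟨crossing i j (Sector.ne_of_height_eq hz' hi hj), hi, hj, by linarith⟩
    · exact ⟨apex i, hi, (sector_congr hz' i).1 hi, by linarith⟩
  · obtain ⟨i, hi⟩ := exists_sector hx (Or.inl rfl) g1 hz
    have hne : ¬ (x 2 = 3 / 8 ∨ 1 / 2 ≤ x 2) := fun h => g2 ((gap_eq_gap h).symm.trans g1)
    push Not at hne
    rcases lt_or_gt_of_ne hne.1 with hz' | hz'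
    · exact ⟨inner i, hi, g2, hz'⟩
    · exact ⟨loopRight i, hi, g2, hz', hne.2⟩
  · obtain ⟨i, hi⟩ := exists_sector hx (Or.inr rfl) g2 hz
    have hne : ¬ (x 2 = 3 / 8 ∨ 1 / 2 ≤ x 2) := fun h => g1 ((gap_eq_gap h).trans g2)
    push Not at hne
    rcases lt_or_gt_of_ne hne.1 with hz' | hz'
    · exact ⟨outer i, hi, g1, hz'⟩
    · exact ⟨loopLeft i, hi, g1, hz', hne.2⟩
  · exact ⟨offWalls, Or.inl ⟨g1, g2⟩⟩

end GaugeChart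

/-- The fourfold covering of the complement of the tangle of `A`. -/
noncomputable def tangleLocalSystem :
    ChartedLocalSystem ↥(blockA.space \ blockA.tangle) FieldFour where
  Index := GaugeChart
  source c := Subtype.val ⁻¹' c.source
  gauge c x := gaugeValue c.gauge x
  isOpen_source c := c.isOpen_source.preimage continuous_subtype_val
  exists_mem_source x := GaugeChart.exists_mem_source x.2
  locally_constant c c' x hc hc' := continuous_subtype_val.continuousAt.eventually
    (eventually_gaugeValue_mul_inv x.2 (c.isGaugeAt x hc) (c'.isGaugeAt x hc'))

/-- Over the inner sphere the covering has the section `0`. -/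
theorem isFlatAlong_zero {Y : Type*} [TopologicalSpace Y]
    (c : Y → ↥(blockA.space \ blockA.tangle)) (hc : ∀ y, ‖(c y : E3)‖ = 1) :
    tangleLocalSystem.IsFlatAlong c fun _ => 0 := by
  have hoff : ∀ y, (c y : E3) ∈ GaugeChart.offWalls.source →
      ∃ i, c y ∈ tangleLocalSystem.source i ∧ ∀ᶠ y' in 𝓝 y,
        tangleLocalSystem.gauge i (c y') 0 = tangleLocalSystem.gauge i (c y) 0 :=
    fun y hy => ⟨GaugeChart.offWalls, hy, Filter.Eventually.of_forall fun _ => rfl⟩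
  intro y
  rcases lt_or_ge (1 / 2) ((c y : E3) 2) with hz | hz
  · exact hoff y (Or.inr hz)
  by_cases g2 : gap 1 (c y) = 0
  · exact absurd (eq_of_norm_eq_one (hc y) (Or.inr rfl) g2 hz).1 (by norm_num)
  by_cases g1 : gap (-1) (c y) = 0
  · obtain ⟨i, hi⟩ := exists_sector (c y).2 (Or.inl rfl) g1 hz
    have hz0 := (eq_of_norm_eq_one (hc y) (Or.inl rfl) g1 hz).2
    refine ⟨GaugeChart.inner i, ⟨hi, g2, by rw [hz0]; norm_num⟩, ?_⟩
    -- The inner sphere crosses walls only at the equator and only in the inner part, where crossing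
    -- is linear and fixes `0`.
    have hall : ∀ x, gaugeValue (GaugeChart.inner i).gauge x 0 = 0 := by
      intro x
      simp only [gaugeValue, GaugeChart.inner]
      split_ifs
      exacts [innerWall_zero i, rfl]
    exact Filter.Eventually.of_forall fun y' => (hall _).trans (hall _).symm
  · exact hoff y (Or.inl ⟨g1, g2⟩)

/-! ### A path with nontrivial monodromy -/

/-- Half of an ellipse that joins the poles of the inner sphere and touches the outer one. -/
noncomputable def halfEllipse (t : ℝ) : E3 :=
  !₂[Real.sin (Real.pi * t), √3 * Real.sin (Real.pi * t), Real.cos (Real.pi * t)]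

theorem continuous_halfEllipse : Continuous halfEllipse := by
  refine (PiLp.continuous_toLp 2 _).comp (continuous_pi fun i => ?_)
  fin_cases i <;> simp <;> fun_prop

theorem axisDist_halfEllipse {t : ℝ} (ht : t ∈ Icc (0 : ℝ) 1) :
    axisDist (halfEllipse t) = 2 * Real.sin (Real.pi * t) := by
  have hs : 0 ≤ Real.sin (Real.pi * t) := Real.sin_nonneg_of_nonneg_of_le_pi
    (mul_nonneg Real.pi_pos.le ht.1) (by nlinarith [Real.pi_pos, ht.2])
  have h3 : √3 ^ 2 = 3 := Real.sq_sqrt (by norm_num)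
  rw [axisDist, ← Real.sqrt_sq (show 0 ≤ 2 * Real.sin (Real.pi * t) by positivity)]
  congr 1
  change Real.sin (Real.pi * t) ^ 2 + (√3 * Real.sin (Real.pi * t)) ^ 2 = _
  rw [mul_pow, h3]
  ring

theorem halfEllipse_mem_space {t : ℝ} (ht : t ∈ Icc (0 : ℝ) 1) :
    halfEllipse t ∈ blockA.space := by
  have hn := norm_sq_eq_axisDist_sq (halfEllipse t)
  rw [axisDist_halfEllipse ht] at hn
  change _ = _ + Real.cos (Real.pi * t) ^ 2 at hn
  have h1 := Real.sin_sq_add_cos_sq (Real.pi * t)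
  have h0 := norm_nonneg (halfEllipse t)
  constructor
  · change 1 ≤ ‖halfEllipse t‖
    nlinarith [sq_nonneg (Real.sin (Real.pi * t))]
  · change ‖halfEllipse t‖ ≤ 2
    nlinarith [sq_nonneg (Real.cos (Real.pi * t))]

/-- Once the half ellipse has come down to height `1/2` it is already outside both surfaces, and it
stays there until the equator. So it can only have met the cylinder above the loop, which carries no
monodromy. -/
theorem gap_halfEllipse_pos {t : ℝ} (ht : t ∈ Icc (0 : ℝ) 1) (h0 : 0 < halfEllipse t 2)
    (h1 : halfEllipse t 2 ≤ 1 / 2) : 0 < gap (-1) (halfEllipse t) ∧ 0 < gap 1 (halfEllipse t) := by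
  have hs := foldParam_sq h1
  have hs0 := foldParam_nonneg (halfEllipse t)
  have hr := axisDist_halfEllipse ht
  have hn : axisDist (halfEllipse t) ^ 2 = 4 - 4 * halfEllipse t 2 ^ 2 := by
    rw [hr]
    change _ = 4 - 4 * Real.cos (Real.pi * t) ^ 2
    linear_combination 4 * Real.sin_sq_add_cos_sq (Real.pi * t)
  have hr0 : 0 ≤ axisDist (halfEllipse t) := Real.sqrt_nonneg _
  unfold gap tangleRadius
  set s := foldParam (halfEllipse t)
  set r := axisDist (halfEllipse t)
  set z := halfEllipse t 2
  have hz : z = (1 - s ^ 2) / 2 := by linarith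
  have hs1 : s < 1 := by nlinarith
  -- Up to height `1/2` one has `r² ≥ 3`, while the profile radius for `ε = -1` stays below `17/10`.
  have hr3 : 17 / 10 < r := by nlinarith
  constructor
  · nlinarith [mul_nonneg hs0 (sq_nonneg (s - 1 / 2))]
  · set q := 2 / 3 * s ^ 2 + 2 / 3 * s + 1 / 2 with hq
    have hq0 : 0 < q := by positivity
    have h2 : (1 - s) * q ≤ 1 := by
      have : 0 ≤ s ^ 3 := by positivity
      have e : (1 - s) * q = 1 / 2 + s / 6 - 2 / 3 * s ^ 3 := by rw [hq]; ring
      linarith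
    have h3 : (1 - s) * q * q ≤ 1 * q := mul_le_mul_of_nonneg_right h2 hq0.le
    have h4 : (1 - s) * (1 + s) ^ 2 < 3 * q := by
      have : 0 ≤ s ^ 2 * (1 + s) := by positivity
      nlinarith [sq_nonneg s]
    have h5 : (1 - s) * ((1 - s) * (1 + s) ^ 2 + (1 - s) * q * q) < (1 - s) * (4 * q) :=
      mul_lt_mul_of_pos_left (by linarith) (by linarith)
    have h6 : (2 - (1 - s) * q) ^ 2 < r ^ 2 := by
      rw [hn, hz]
      linarith
    have h7 := lt_of_pow_lt_pow_left₀ 2 hr0 h6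
    rw [hq] at h7
    linarith

theorem gap_halfEllipse_neg {t : ℝ} (ht : t ∈ Icc (0 : ℝ) 1) (h : halfEllipse t 2 ≤ 0) :
    0 < gap (-1) (halfEllipse t) ∧ gap 1 (halfEllipse t) ≤ 0 := by
  have hs := foldParam_sq (x := halfEllipse t) (by linarith)
  have hs0 := foldParam_nonneg (halfEllipse t)
  have hr := axisDist_halfEllipse ht
  have hn : axisDist (halfEllipse t) ^ 2 = 4 - 4 * halfEllipse t 2 ^ 2 := by
    rw [hr]
    change _ = 4 - 4 * Real.cos (Real.pi * t) ^ 2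
    linear_combination 4 * Real.sin_sq_add_cos_sq (Real.pi * t)
  have hr0 : 0 ≤ axisDist (halfEllipse t) := Real.sqrt_nonneg _
  have hr2 : axisDist (halfEllipse t) ≤ 2 := by
    rw [hr]
    linarith [Real.sin_le_one (Real.pi * t)]
  have e1 := tangleRadius_sub_one (-1 * foldParam (halfEllipse t))
  have e2 := two_sub_tangleRadius (1 * foldParam (halfEllipse t))
  unfold gap
  set s := foldParam (halfEllipse t)
  set r := axisDist (halfEllipse t)
  set z := halfEllipse t 2
  have hs1 : 1 ≤ s := by nlinarith
  set q := 2 / 3 * s ^ 2 + 2 / 3 * s + 1 / 2 with hq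
  have hq0 : 0 < q := by positivity
  have hp : 0 ≤ (s - 1) * q := mul_nonneg (by linarith) hq0.le
  have e1' : tangleRadius (-1 * s) = 1 - (s - 1) * q := by
    rw [hq]
    linarith
  have e2' : tangleRadius (1 * s) = 2 + (s - 1) * q := by
    rw [hq]
    linarith
  constructor
  -- Down to height `-3/4` the half ellipse has `r > 1`, and the profile radius is at most `1`;
  -- further down the profile radius is negative.
  · rcases le_or_gt (-(3 / 4)) z with hz | hz
    · have : 1 < r := by nlinarith
      linarith
    · have hs2 : 3 / 2 < s := by nlinarith
      have hq2 : 3 < q := by nlinarith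
      have : 1 / 2 * 3 < (s - 1) * q := mul_lt_mul'' (by linarith) hq2 (by norm_num) (by norm_num)
      linarith
  · linarith

/-- At the equator the half ellipse is in the direction of angle `π/3`, midway between the outer
ends of the components `0` and `1`. -/
theorem sector_halfEllipse {t : ℝ} (ht : t ∈ Icc (0 : ℝ) 1) (h : halfEllipse t 2 = 0) :
    Sector 1 0 (halfEllipse t) := by
  have hfold : foldParam (halfEllipse t) = 1 := by
    rw [foldParam, h]
    simp
  have hangle : tangleAngle (1 * foldParam (halfEllipse t)) = 0 := by
    rw [hfold, tangleAngle]
    ring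
  have hsin : 0 < Real.sin (Real.pi * t) := by
    have h1 := Real.sin_sq_add_cos_sq (Real.pi * t)
    have h2 : Real.cos (Real.pi * t) = 0 := h
    have h3 : 0 ≤ Real.sin (Real.pi * t) := Real.sin_nonneg_of_nonneg_of_le_pi
      (mul_nonneg Real.pi_pos.le ht.1) (by nlinarith [Real.pi_pos, ht.2])
    rw [h2] at h1
    nlinarith
  have hre : relRe 1 (halfEllipse t) = Real.sin (Real.pi * t) := by
    rw [relRe, hangle]
    simp [halfEllipse]
  have him : relIm 1 (halfEllipse t) = √3 * Real.sin (Real.pi * t) := by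
    rw [relIm, hangle]
    simp [halfEllipse]
  rw [Sector, hre, him]
  constructor <;> positivity

theorem halfEllipse_mem {t : ℝ} (ht : t ∈ Icc (0 : ℝ) 1) :
    halfEllipse t ∈ blockA.space \ blockA.tangle := by
  have hsp := halfEllipse_mem_space ht
  refine ⟨hsp, fun h => ?_⟩
  obtain ⟨ε, hε, hg, hz, hno⟩ := exists_gap_eq_zero_of_mem_tangle h
  rcases lt_or_ge 0 (halfEllipse t 2) with h0 | h0
  · have := gap_halfEllipse_pos ht h0 hz
    rcases hε with rfl | rfl
    exacts [this.1.ne' hg, this.2.ne' hg]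
  · rcases hε with rfl | rfl
    · exact (gap_halfEllipse_neg ht h0).1.ne' hg
    · exact hno 0 (sector_halfEllipse ht (le_antisymm h0 (height_nonneg hsp (Or.inr rfl) hg)))

open Classical in
/-- Along the half ellipse there is a flat family that jumps from `0` to `1` at the equator. -/
theorem isFlatAlong_halfEllipse :
    tangleLocalSystem.IsFlatAlong (fun t : I => ⟨halfEllipse t, halfEllipse_mem t.2⟩)
      fun t => if 0 < halfEllipse t 2 then 0 else (1, 0) := by
  have hcont : Continuous fun t : I => halfEllipse t 2 :=
    continuous_height.comp (continuous_halfEllipse.comp continuous_subtype_val)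
  intro t
  rcases lt_trichotomy (halfEllipse t 2) 0 with h0 | h0 | h0
  · refine ⟨GaugeChart.offWalls, Or.inl ⟨(gap_halfEllipse_neg t.2 h0.le).1.ne', fun hg => ?_⟩, ?_⟩
    · linarith [height_nonneg (halfEllipse_mem_space t.2) (Or.inr rfl) hg]
    · filter_upwards [hcont.continuousAt.eventually (gt_mem_nhds h0)] with t' ht'
      rw [if_neg h0.not_gt, if_neg ht'.not_gt]
      rfl
  · have hg1 := (gap_halfEllipse_neg t.2 h0.le).1
    refine ⟨GaugeChart.outer 0, ⟨sector_halfEllipse t.2 h0, hg1.ne', ?_⟩, ?_⟩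
    · simp only [h0]
      norm_num
    -- In this chart both values become `0`: above the equator the gauge is the identity, and below
    -- it is `outerWall 0`, which sends `1` to `1 + 1 = 0`.
    have hall : ∀ t' : I, halfEllipse t' 2 < 1 / 2 →
        gaugeValue (GaugeChart.outer 0).gauge (halfEllipse t')
          (if 0 < halfEllipse t' 2 then 0 else (1, 0)) = 0 := by
      intro t' ht'
      split_ifs with hpos
      · have := (gap_halfEllipse_pos t'.2 hpos ht'.le).2
        simp [gaugeValue, GaugeChart.outer, this]
      · have := (gap_halfEllipse_neg t'.2 (not_lt.1 hpos)).2.not_gt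
        simpa [gaugeValue, GaugeChart.outer, this] using outerWall_zero_apply
    filter_upwards [hcont.continuousAt.eventually
      (gt_mem_nhds (show halfEllipse t 2 < 1 / 2 by rw [h0]; norm_num))] with t' ht'
    exact (hall t' ht').trans (hall t (by rw [h0]; norm_num)).symm
  · refine ⟨GaugeChart.offWalls, ?_, ?_⟩
    · rcases lt_or_ge (1 / 2) (halfEllipse t 2) with h1 | h1
      · exact Or.inr h1
      · have := gap_halfEllipse_pos t.2 h0 h1
        exact Or.inl ⟨this.1.ne', this.2.ne'⟩
    · filter_upwards [hcont.continuousAt.eventually (lt_mem_nhds h0)] with t' ht'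
      rw [if_pos h0, if_pos ht']
      rfl

theorem halfEllipse_zero_height : halfEllipse 0 2 = 1 := by
  change Real.cos (Real.pi * 0) = 1
  simp

theorem halfEllipse_one_height : halfEllipse 1 2 = -1 := by
  change Real.cos (Real.pi * 1) = -1
  simp

theorem norm_halfEllipse_of_sq {t : ℝ} (ht : t ∈ Icc (0 : ℝ) 1) (h : halfEllipse t 2 ^ 2 = 1) :
    ‖halfEllipse t‖ = 1 := by
  have hn := norm_sq_eq_axisDist_sq (halfEllipse t)
  have h2 : Real.cos (Real.pi * t) ^ 2 = 1 := h
  rw [axisDist_halfEllipse ht, h, mul_pow, Real.sin_sq, h2] at hn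
  have h0 := norm_nonneg (halfEllipse t)
  nlinarith

/-! ### The contradiction and the conclusion -/

theorem not_diffeomorphic_of_isTrivial {n : ℕ} {E : Block} (hE : E.IsTrivial n) :
    ¬ blockA.Diffeomorphic E := by
  intro h
  have h0I : (0 : ℝ) ∈ Icc (0 : ℝ) 1 := by simp
  have h1I : (1 : ℝ) ∈ Icc (0 : ℝ) 1 := by simp
  have hn0 : ‖halfEllipse 0‖ = 1 :=
    norm_halfEllipse_of_sq h0I (by rw [halfEllipse_zero_height]; norm_num)
  have hn1 : ‖halfEllipse 1‖ = 1 :=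
    norm_halfEllipse_of_sq h1I (by rw [halfEllipse_one_height]; norm_num)
  obtain ⟨H, hH, hmem, hzero, hone, hfix⟩ := h.exists_deformation hE hn0
  have hcont : Continuous fun p : I × I => H (p.1, halfEllipse p.2) :=
    hH.comp_continuous ((continuous_subtype_val.comp continuous_fst).prodMk
      (continuous_halfEllipse.comp (continuous_subtype_val.comp continuous_snd)))
      fun p => ⟨p.1.2, halfEllipse_mem p.2.2⟩
  let c₀ : C(I, ↥(blockA.space \ blockA.tangle)) :=
    ⟨fun t => ⟨halfEllipse t, halfEllipse_mem t.2⟩,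
      (continuous_halfEllipse.comp continuous_subtype_val).subtype_mk _⟩
  let c₁ : C(I, ↥(blockA.space \ blockA.tangle)) :=
    ⟨fun t => ⟨H (1, halfEllipse t), hmem 1 h1I _ (halfEllipse_mem t.2)⟩,
      (hcont.comp (continuous_const (y := (1 : I)).prodMk continuous_id)).subtype_mk _⟩
  -- Both ends of the half ellipse are poles of the inner sphere, which the deformation fixes
  -- pointwise.
  have hrel : c₀.HomotopicRel c₁ {0, 1} := by
    refine ⟨⟨⟨⟨fun p => ⟨H (p.1, halfEllipse p.2), hmem _ p.1.2 _ (halfEllipse_mem p.2.2)⟩,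
      hcont.subtype_mk _⟩, fun t => Subtype.ext (hzero _ (halfEllipse_mem t.2)),
      fun t => rfl⟩, ?_⟩⟩
    intro s t ht
    refine Subtype.ext (hfix _ s.2 _ (halfEllipse_mem t.2) ?_)
    rcases ht with rfl | rfl
    exacts [hn0, hn1]
  -- Both transports start with `0` at the north pole; at the south pole one ends with `1` and the
  -- other, inside the inner sphere, with `0`.
  have := tangleLocalSystem.eq_of_homotopicRel hrel isFlatAlong_halfEllipse
    (isFlatAlong_zero c₁ fun t => hone _ (halfEllipse_mem t.2))
    (by simp [halfEllipse_zero_height])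
  simp only [Icc.coe_one, halfEllipse_one_height] at this
  revert this
  norm_num

theorem diffeomorphic_of_mem_blocksB {B : Block} (hB : B ∈ blocksB) : blockA.Diffeomorphic B := by
  rcases hB with rfl | rfl | rfl | rfl
  · exact blockA.diffeomorphic_refl
  · exact blockA.diffeomorphic_bar
  · exact blockA.diffeomorphic_star
  · exact blockA.diffeomorphic_star.trans blockA.star.diffeomorphic_bar

theorem mainTheorem10 :
    (∀ E : Block, E.IsTrivial 3 → ¬ blockA.Diffeomorphic E) ∧
    (∀ B ∈ blocksB, ∀ C ∈ blocksB, B.Diffeomorphic C) ∧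
    (∀ B ∈ blocksB, ∀ E : Block, E.IsTrivial 3 → ¬ B.Diffeomorphic E) :=
  ⟨fun _ hE => not_diffeomorphic_of_isTrivial hE,
    fun _ hB _ hC => (diffeomorphic_of_mem_blocksB hB).symm.trans (diffeomorphic_of_mem_blocksB hC),
    fun _ hB _ hE h => not_diffeomorphic_of_isTrivial hE ((diffeomorphic_of_mem_blocksB hB).trans h)⟩
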